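/- Let $\mathscr P$ be the set of all partitions of non-negative integers; for $\lambda\in\mathscr P$ let $|\lambda|$ be its size and $r_m(\lambda)$ the number of parts of $\lambda$ equal to $m$. For $f:\mathscr P\to\mathbb Q$ define the $q$-bracket $$\langle f\rangle_q=\frac{\sum_{\lambda\in\mathscr P}f(\lambda)\,q^{|\lambda|}}{\sum_{\lambda\in\mathscr P}q^{|\lambda|}}\in\mathbb Q[[q]]$$ and the degree $$\deg(f)=\inf\Bigl\{a\in\mathbb R:\ \lim_{q\to1^-}(1-q)^a\langle f\rangle_q\text{ converges}\Bigr\},$$ where $q$ is real, $\langle f\rangle_q$ is required to converge for all $q<1$ close to $1$, and convergence means convergence to a real number. If $\deg(f)$ is finite, let $Z_{\deg}(f)=\lim_{q\to1^-}(1-q)^{\deg(f)}\langle f\rangle_q$ whenever this limit exists. For $p\in\mathbb Q[x_1,\dots,x_n,y_1,\dots,y_n]$ let $\Psi(p):\mathscr P\to\mathbb Q$ be the function $$\Psi(p)(\lambda)=\sum_{m_1>\cdots>m_n>0}\ \sum_{s_1=1}^{r_{m_1}(\lambda)}\cdots\sum_{s_n=1}^{r_{m_n}(\lambda)}p(m_1,\dots,m_n,s_1,\dots,s_n).$$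 For an integer $w\ge0$ let $\mathcal Z_{\le w}\subset\mathbb R$ be the $\mathbb Q$-vector space spanned by the multiple zeta values $$\zeta(k_1,\dots,k_s)=\sum_{m_1>\cdots>m_s>0}\frac1{m_1^{k_1}\cdots m_s^{k_s}},\qquad s\ge1,\ k_1\ge2,\ k_2,\dots,k_s\ge1,\ k_1+\cdots+k_s\le w.$$ **Theorem.** Let $r\ge1$, let $d_1,\dots,d_r,l_1,\dots,l_r$ be non-negative integers, and let $f=\Psi\bigl(\prod_{i=1}^r x_i^{d_i}y_i^{l_i}\bigr)$. Then $$\deg(f)=\max_{0\le j\le r}\Bigl\{\sum_{i\le j}(d_i+1)+\sum_{i>j}(l_i+1)\Bigr\}.$$ Moreover, if this maximum is attained for a unique value of $j$, then the limit $Z_{\deg}(f)$ exists as a real number and $Z_{\deg}(f)\in\mathcal Z_{\le\deg(f)}$. -/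

import Mathlib

open Filter Topology

noncomputable section

namespace PartitionAnalogue

/-- The set of all partitions of all non-negative integers: a pair `⟨n, lam⟩` with `lam` a
partition of `n`, so that the first component is the size `|lam|`. -/
abbrev Partitions : Type := Σ n : ℕ, n.Partition

/-- `mult lam m` is the number `r_m(lam)` of times that `m` occurs as a part of `lam`. -/
def mult (lam : Partitions) (m : ℕ) : ℕ := lam.2.parts.count m

/-- The generating series `∑_lam f(lam) q^|lam|` as a formal power series. -/
def genSeries (f : Partitions → ℚ) : PowerSeries ℚ :=
  PowerSeries.mk fun n => ∑ lam : n.Partition, f ⟨n, lam⟩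

/-- The `q`-bracket of `f`, a formal power series; the denominator has constant coefficient `1`,
so the inverse is the genuine one. -/
def qBracket (f : Partitions → ℚ) : PowerSeries ℚ :=
  genSeries f * (genSeries fun _ => 1)⁻¹

/-- The `n`-th term of the `q`-bracket of `f` at the real number `q`. -/
def qBracketTerm (f : Partitions → ℚ) (q : ℝ) (n : ℕ) : ℝ :=
  ((PowerSeries.coeff n (qBracket f) : ℚ) : ℝ) * q ^ n

/-- `(1 - q)^a ⟨f⟩_q` converges to the real number `L` as `q` tends to `1` from below: the power
series `⟨f⟩_q` converges for all `q < 1` near `1`, and its sum, multiplied by `(1 - q)^a`, tends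
to `L`. -/
def HasLimitAt (f : Partitions → ℚ) (a L : ℝ) : Prop :=
  (∀ᶠ q : ℝ in 𝓝[<] 1, Summable (qBracketTerm f q)) ∧
    Tendsto (fun q : ℝ => (1 - q) ^ a * ∑' n, qBracketTerm f q n) (𝓝[<] 1) (𝓝 L)

/-- The degree of `f`: the infimum, in the extended reals, of all real `a` for which
`(1 - q)^a ⟨f⟩_q` converges as `q → 1`. -/
def degree (f : Partitions → ℚ) : EReal :=
  sInf ((fun a : ℝ => (a : EReal)) '' {a : ℝ | ∃ L : ℝ, HasLimitAt f a L})

/-- `Z` is the degree limit of `f`: the degree of `f` is a real number `a`, and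
`(1 - q)^a ⟨f⟩_q` converges to `Z`. -/
def IsDegreeLimit (f : Partitions → ℚ) (Z : ℝ) : Prop :=
  ∃ a : ℝ, degree f = (a : EReal) ∧ HasLimitAt f a Z

/-- The function `Ψ(p)` for `p ∈ ℚ[x_1, …, x_n, y_1, …, y_n]`; the variables `x` are indexed by the
left summand and the variables `y` by the right one. No part of `lam` exceeds `|lam|`, so all
tuples `m_1 > … > m_n > 0` with an entry above `|lam|` have an empty inner sum; this is why the
range `1, …, |lam|` suffices for each `m_i`. -/
def Psi {n : ℕ} (p : MvPolynomial (Fin n ⊕ Fin n) ℚ) (lam : Partitions) : ℚ :=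
  open Classical in
  ∑ m ∈ (Fintype.piFinset fun _ : Fin n => Finset.Icc 1 lam.1).filter (fun m => StrictAnti m),
    ∑ s ∈ Fintype.piFinset fun i : Fin n => Finset.Icc 1 (mult lam (m i)),
      MvPolynomial.eval (Sum.elim (fun i => (m i : ℚ)) (fun i => (s i : ℚ))) p

/-- The monomial `∏ x_i^{d_i} y_i^{l_i}`. -/
def monom {r : ℕ} (d l : Fin r → ℕ) : MvPolynomial (Fin r ⊕ Fin r) ℚ :=
  ∏ i, MvPolynomial.X (Sum.inl i) ^ d i * MvPolynomial.X (Sum.inr i) ^ l i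

/-- `∑_{i ≤ j} (d_i + 1) + ∑_{i > j} (l_i + 1)` for `j ∈ {0, …, r}`. The indices `i` run from `1`
to `r` in this formula and from `0` to `r - 1` in `Fin r`. -/
def exponent {r : ℕ} (d l : Fin r → ℕ) (j : Fin (r + 1)) : ℕ :=
  ∑ i : Fin r, if (i : ℕ) < (j : ℕ) then d i + 1 else l i + 1

/-- The maximum over `j ∈ {0, …, r}` of the numbers `exponent d l j`. -/
def maxExponent {r : ℕ} (d l : Fin r → ℕ) : ℕ :=
  Finset.univ.sup' Finset.univ_nonempty (exponent d l)

/-- The multiple zeta value `ζ(k_1, …, k_r) = ∑_{m_1 > … > m_r > 0} ∏ m_i^{-k_i}`. -/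
def mzv {r : ℕ} (k : Fin r → ℕ) : ℝ :=
  ∑' m : {m : Fin r → ℕ // StrictAnti m ∧ ∀ i, 0 < m i}, ∏ i, 1 / ((m.1 i : ℝ) ^ k i)

/-- The `ℚ`-vector space spanned by the multiple zeta values of depth at least `1` and weight at
most `w`, over the indices with `k_1 ≥ 2` and all `k_i ≥ 1` (where the series converges). -/
def mzvSpace (w : ℕ) : Submodule ℚ ℝ :=
  Submodule.span ℚ {z : ℝ | ∃ (r : ℕ) (k : Fin (r + 1) → ℕ),
    2 ≤ k 0 ∧ (∀ i, 1 ≤ k i) ∧ ∑ i, k i ≤ w ∧ z = mzv k}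

end PartitionAnalogue

end

open scoped NNReal ENNReal Nat

noncomputable section

namespace PartitionAnalogue

/-! Write A_e(x) = ∑_{u ≥ 1} u^e x^u. Removing prescribed parts from a partition leaves an arbitrary
partition, so the partition generating function cancels in the bracket (`genSeries_psi`), leaving
⟨f⟩_q = ∑_{m_1 > ⋯ > m_r > 0} ∏ m_i^{d_i} A_{l_i}(q^{m_i}). For fixed n, (1-q)^{e+1} A_e(q^n) tends
to e!/n^{e+1}.

Each j corresponds to a regime in which m_1, …, m_j are large and the other variables stay bounded.
The large variables are traded for their conjugates (`tsum_transfer`): the new variables are partial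
sums of multiplicities, the gaps between the m_i take the role of multiplicities, and powers of m_i
= gap + m_{i+1} are expanded binomially. The result (`Expansion`) is a finite positive combination
of sums over a left chain with top n and a right chain with top m, coupled only by m^D q^{mn}. After
scaling by (1-q)^D the coupling tends to 1 if D = 0 and to 0 otherwise.

If j is the only maximiser, the strict inequalities between the exponents say exactly that both
decoupled limit sums converge (`admissible_drop`, `admissible_take_reverse`). Dominated convergence
(`Expansion.tendsto`) then gives a combination of products of two nested sums ∑ ∏ n_i^{-k_i} with
integer k_i. Faulhaber's formula removes the entries k_i ≤ 0 without raising the weight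
(`zh_mem_span_betterZh`), and the quasi-shuffle product handles the products (`mul_mem_mzvSpace`).

The degree needs no uniqueness. A single positive term of the expansion at any maximiser j bounds
the bracket from below (`Expansion.exists_lower`). From above, any exponent beyond the maximum
suffices, since the surplus power of 1-q makes the untransformed sum converge (`exists_upper`). -/

/-! ### Behaviour of ∑ u^e x^u near x = 1 -/

/-- The sum `∑_{u ≥ 1} u^e x^u`. -/
def powerGeom (e : ℕ) (x : ℝ≥0) : ℝ≥0 := ∑' u : ℕ, ((u + 1 : ℕ) : ℝ≥0) ^ e * x ^ (u + 1)

lemma summable_powerGeom (e : ℕ) {x : ℝ≥0} (hx : x < 1) :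
    Summable fun u : ℕ => ((u + 1 : ℕ) : ℝ≥0) ^ e * x ^ (u + 1) := by
  rw [← NNReal.summable_coe]
  have h := summable_pow_mul_geometric_of_norm_lt_one (R := ℝ) e (r := (x : ℝ))
    (by simpa using hx)
  have h2 := (summable_nat_add_iff 1).2 h
  simpa using h2

lemma coe_powerGeom (e : ℕ) (x : ℝ≥0) :
    (powerGeom e x : ℝ) = ∑' u : ℕ, ((u + 1 : ℕ) : ℝ) ^ e * (x : ℝ) ^ (u + 1) := by
  rw [powerGeom, NNReal.coe_tsum]
  simp

lemma summable_powerGeom_real (e : ℕ) {x : ℝ≥0} (hx : x < 1) :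
    Summable fun u : ℕ => ((u + 1 : ℕ) : ℝ) ^ e * (x : ℝ) ^ (u + 1) := by
  have := NNReal.summable_coe.2 (summable_powerGeom e hx)
  simpa using this

/-- Here e!·C(u+e, e) = (u+1)⋯(u+e) lies between (u+1)^e and (u+e+1)^e. The shift k = 1 therefore
gives the upper bound for `powerGeom`, and k = e+1 the lower one. -/
lemma hasSum_factorial_choose (e : ℕ) {x : ℝ≥0} (hx : x < 1) (k : ℕ) :
    HasSum (fun u : ℕ => (e ! : ℝ) * ((u + e).choose e : ℝ) * (x : ℝ) ^ (u + k))
      (e ! * (x : ℝ) ^ k / (1 - x) ^ (e + 1)) := by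
  have h := (hasSum_choose_mul_geometric_of_norm_lt_one (𝕜 := ℝ) e (r := (x : ℝ))
    (by simpa using hx)).mul_left ((e ! : ℝ) * (x : ℝ) ^ k)
  rw [← mul_one_div]
  exact h.congr_fun fun u => by rw [pow_add]; ring

lemma powerGeom_le (e : ℕ) {x : ℝ≥0} (hx : x < 1) :
    (powerGeom e x : ℝ) ≤ e ! * x / (1 - x) ^ (e + 1) := by
  have h := hasSum_factorial_choose e hx 1
  rw [pow_one] at h
  rw [coe_powerGeom]
  refine (summable_powerGeom_real e hx).tsum_le_of_sum_le fun s => ?_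
  refine le_trans (Finset.sum_le_sum fun u _ => ?_) (sum_le_hasSum s (fun u _ => by positivity) h)
  gcongr
  have := Nat.pow_succ_le_ascFactorial (u + 1) e
  rw [Nat.ascFactorial_eq_factorial_mul_choose] at this
  exact_mod_cast this

lemma le_powerGeom (e : ℕ) {x : ℝ≥0} (hx : x < 1) :
    e ! * (x : ℝ) ^ (e + 1) / (1 - x) ^ (e + 1) ≤ (powerGeom e x : ℝ) := by
  have h := hasSum_factorial_choose e hx (e + 1)
  rw [coe_powerGeom, ← h.tsum_eq]
  have hs := summable_powerGeom_real e hx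
  have hs' := (summable_nat_add_iff e).2 hs
  refine le_trans (h.summable.tsum_le_tsum (fun u => ?_) hs')
    (tsum_comp_le_tsum_of_inj hs (fun u => by positivity) (add_left_injective e))
  rw [show u + e + 1 = u + (e + 1) by ring]
  gcongr
  have h1 := Nat.descFactorial_le_pow (u + e) e
  rw [Nat.descFactorial_eq_factorial_mul_choose] at h1
  have h2 : (u + e) ^ e ≤ (u + (e + 1)) ^ e := Nat.pow_le_pow_left (by omega) e
  exact_mod_cast h1.trans h2

lemma powerGeom_mono (e : ℕ) {x y : ℝ≥0} (hy : y < 1) (hxy : x ≤ y) :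
    powerGeom e x ≤ powerGeom e y :=
  (summable_powerGeom e (hxy.trans_lt hy)).tsum_le_tsum (fun u => by gcongr)
    (summable_powerGeom e hy)

/-- `y^b e^{-y} ≤ b^b`. -/
lemma rpow_mul_exp_neg_le {b y : ℝ} (hb : 0 ≤ b) (hy : 0 ≤ y) :
    y ^ b * Real.exp (-y) ≤ b ^ b := by
  rcases hb.eq_or_lt with rfl | hb
  · simpa using hy
  have h1 : y / b ≤ Real.exp (y / b) := by linarith [Real.add_one_le_exp (y / b)]
  have h2 : (y / b) ^ b ≤ Real.exp y := by
    calc (y / b) ^ b ≤ (Real.exp (y / b)) ^ b := by gcongr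
      _ = Real.exp y := by rw [← Real.exp_mul]; field_simp
  rw [Real.div_rpow hy hb.le, div_le_iff₀ (by positivity)] at h2
  rw [Real.exp_neg, mul_inv_le_iff₀ (Real.exp_pos _)]
  linarith

lemma pow_le_exp_neg {q : ℝ≥0} (n : ℕ) :
    (q : ℝ) ^ n ≤ Real.exp (-(n * (1 - q))) := by
  have h : (q : ℝ) ≤ Real.exp (-(1 - q)) := by linarith [Real.add_one_le_exp (-(1 - (q : ℝ)))]
  calc (q : ℝ) ^ n ≤ (Real.exp (-(1 - q))) ^ n := by gcongr
    _ = _ := by rw [← Real.exp_nat_mul]; ring_nf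

lemma powerGeom_le_pow (e : ℕ) : ∃ C : ℝ, 0 ≤ C ∧ ∀ (q : ℝ≥0) (n : ℕ), q < 1 → 0 < n →
    (1 - (q : ℝ)) ^ (e + 1) * powerGeom e (q ^ n) ≤ C * (e ! / (n : ℝ) ^ (e + 1)) := by
  -- With y = n(1-q) = (e+1)z, the numerator e^{-y} = (e^{-z})^{e+1} cancels against (z
  -- e^{-z})^{e+1} ≤ (1 - e^{-y})^{e+1}. The constant is the cost of passing from z back to y.
  refine ⟨(e + 1) ^ (e + 1), by positivity, fun q n hq hn => ?_⟩
  have hq' : 0 < 1 - (q : ℝ) := by simpa using hq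
  have hn' : (0 : ℝ) < n := by exact_mod_cast hn
  set y : ℝ := n * (1 - q) with hy
  have hy0 : 0 < y := by positivity
  set z : ℝ := y / (e + 1) with hz
  have hz0 : 0 < z := by positivity
  obtain ⟨x, hxe⟩ : ∃ x : ℝ≥0, (x : ℝ) = Real.exp (-y) := ⟨⟨_, (Real.exp_pos _).le⟩, rfl⟩
  have hx : x < 1 := by
    rw [← NNReal.coe_lt_coe]; simpa [hxe] using hy0
  have h1 : q ^ n ≤ x := by
    rw [← NNReal.coe_le_coe]; simpa [hxe] using pow_le_exp_neg n
  have h2 : (powerGeom e (q ^ n) : ℝ) ≤ e ! * x / (1 - x) ^ (e + 1) :=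
    le_trans (NNReal.coe_le_coe.2 (powerGeom_mono e hx h1)) (powerGeom_le e hx)
  have hxz : (x : ℝ) = (Real.exp (-z)) ^ (e + 1) := by
    rw [← Real.exp_nat_mul, hxe, hz]; congr 1; push_cast; field_simp
  have h3 : z * Real.exp (-z) ≤ 1 - x := by
    have h4 : (x : ℝ) ≤ Real.exp (-z) := by
      rw [hxe]
      gcongr
      rw [hz, div_le_iff₀ (by positivity)]
      nlinarith [(Nat.cast_nonneg e : (0 : ℝ) ≤ e)]
    have h5 : Real.exp (-z) * Real.exp z = 1 := by rw [← Real.exp_add]; simp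
    nlinarith [Real.add_one_le_exp z, Real.exp_pos (-z)]
  have h6 : 0 < z * Real.exp (-z) := by positivity
  have h7 : (x : ℝ) / (1 - x) ^ (e + 1) ≤ 1 / z ^ (e + 1) := by
    calc (x : ℝ) / (1 - x) ^ (e + 1) ≤ x / (z * Real.exp (-z)) ^ (e + 1) := by gcongr
      _ = 1 / z ^ (e + 1) := by
        rw [mul_pow, hxz]
        have := Real.exp_pos (-z)
        field_simp
  calc (1 - (q : ℝ)) ^ (e + 1) * powerGeom e (q ^ n)
      ≤ (1 - (q : ℝ)) ^ (e + 1) * (e ! * (1 / z ^ (e + 1))) := by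
        gcongr
        rw [mul_div_assoc] at h2
        exact h2.trans (by gcongr)
    _ = (e + 1) ^ (e + 1) * (e ! / (n : ℝ) ^ (e + 1)) := by
        rw [hz, hy, div_pow, mul_pow]
        field_simp

/-- Bounding each term by y^a e^{-y} ≤ a^a leaves ∑ u^{e-a}, which converges exactly because a >
e+1. Surplus powers of 1-q thus become decay in n. -/
lemma powerGeom_le_rpow (e : ℕ) {a : ℝ} (ha : e + 1 < a) : ∃ C : ℝ, 0 ≤ C ∧
    ∀ (q : ℝ≥0) (n : ℕ), q < 1 → 0 < n →
      (1 - (q : ℝ)) ^ a * powerGeom e (q ^ n) ≤ C * (n : ℝ) ^ (-a) := by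
  have hs : Summable fun u : ℕ => ((u + 1 : ℕ) : ℝ) ^ ((e : ℝ) - a) :=
    (summable_nat_add_iff 1).2 (Real.summable_nat_rpow.2 (by linarith))
  have ha0 : 0 ≤ a := by linarith [(Nat.cast_nonneg e : (0 : ℝ) ≤ e)]
  refine ⟨a ^ a * ∑' u : ℕ, ((u + 1 : ℕ) : ℝ) ^ ((e : ℝ) - a), mul_nonneg (by positivity)
    (tsum_nonneg fun u => by positivity), fun q n hq hn => ?_⟩
  have hq' : 0 < 1 - (q : ℝ) := by simpa using hq
  have hn' : (0 : ℝ) < n := by exact_mod_cast hn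
  have hqn : q ^ n < 1 := pow_lt_one₀ zero_le hq hn.ne'
  rw [coe_powerGeom, mul_assoc, mul_comm (a ^ a), mul_assoc, ← tsum_mul_left, ← tsum_mul_right]
  refine (Summable.mul_left _ (summable_powerGeom_real e hqn)).tsum_le_tsum (fun u => ?_)
    (hs.mul_right _)
  set v : ℝ := ((u + 1 : ℕ) : ℝ) with hv
  have hv0 : 0 < v := by positivity
  have h1 : ((q ^ n : ℝ≥0) : ℝ) ^ (u + 1) ≤ Real.exp (-(v * (n * (1 - q)))) := by
    have := pow_le_exp_neg (q := q) (n * (u + 1))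
    rw [NNReal.coe_pow, ← pow_mul]
    refine this.trans_eq ?_
    rw [hv]; push_cast; ring_nf
  have h2 := rpow_mul_exp_neg_le ha0 (y := v * (n * (1 - q))) (by positivity)
  rw [Real.mul_rpow hv0.le (by positivity), Real.mul_rpow hn'.le hq'.le] at h2
  calc (1 - (q : ℝ)) ^ a * (v ^ e * ((q ^ n : ℝ≥0) : ℝ) ^ (u + 1))
      ≤ (1 - (q : ℝ)) ^ a * (v ^ e * Real.exp (-(v * (n * (1 - q))))) := by gcongr
    _ = v ^ ((e : ℝ) - a) * (v ^ a * ((n : ℝ) ^ a * (1 - (q : ℝ)) ^ a) *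
          Real.exp (-(v * (n * (1 - q))))) * (n : ℝ) ^ (-a) := by
        rw [Real.rpow_sub hv0, Real.rpow_natCast, Real.rpow_neg hn'.le]
        have := Real.rpow_pos_of_pos hv0 a
        have := Real.rpow_pos_of_pos hn' a
        field_simp
    _ ≤ v ^ ((e : ℝ) - a) * a ^ a * (n : ℝ) ^ (-a) := by gcongr
    _ = _ := by ring

lemma tendsto_coe_one : Tendsto (fun q : ℝ≥0 => (q : ℝ)) (𝓝[<] 1) (𝓝 1) :=
  (NNReal.continuous_coe.tendsto 1).mono_left nhdsWithin_le_nhds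

lemma tendsto_powerGeom (e : ℕ) {n : ℕ} (hn : 0 < n) :
    Tendsto (fun q : ℝ≥0 => (1 - (q : ℝ)) ^ (e + 1) * powerGeom e (q ^ n)) (𝓝[<] 1)
      (𝓝 (e ! / (n : ℝ) ^ (e + 1))) := by
  have hg : Tendsto (fun q : ℝ≥0 => ∑ i ∈ Finset.range n, (q : ℝ) ^ i) (𝓝[<] 1) (𝓝 n) := by
    have := tendsto_finsetSum (Finset.range n) fun i _ => tendsto_coe_one.pow i
    simpa using this
  have hn' : (n : ℝ) ^ (e + 1) ≠ 0 := by positivity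
  have hlo : Tendsto (fun q : ℝ≥0 => e ! * ((q : ℝ) ^ n) ^ (e + 1) /
      (∑ i ∈ Finset.range n, (q : ℝ) ^ i) ^ (e + 1)) (𝓝[<] 1) (𝓝 (e ! / (n : ℝ) ^ (e + 1))) := by
    have := ((((tendsto_coe_one.pow n).pow (e + 1)).const_mul (e ! : ℝ))).div (hg.pow (e + 1)) hn'
    simpa [Pi.div_def] using this
  have hhi : Tendsto (fun q : ℝ≥0 => e ! * ((q : ℝ) ^ n) /
      (∑ i ∈ Finset.range n, (q : ℝ) ^ i) ^ (e + 1)) (𝓝[<] 1) (𝓝 (e ! / (n : ℝ) ^ (e + 1))) := by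
    have := (((tendsto_coe_one.pow n).const_mul (e ! : ℝ))).div (hg.pow (e + 1)) hn'
    simpa [Pi.div_def] using this
  have key : ∀ q : ℝ≥0, q < 1 → ∀ y : ℝ, (1 - (q : ℝ)) ^ (e + 1) * (y / (1 - (q : ℝ) ^ n) ^ (e + 1))
      = y / (∑ i ∈ Finset.range n, (q : ℝ) ^ i) ^ (e + 1) := by
    intro q hq y
    have hq' : 0 < 1 - (q : ℝ) := by simpa using hq
    have : 1 - (q : ℝ) ^ n = (1 - q) * ∑ i ∈ Finset.range n, (q : ℝ) ^ i :=
      (mul_neg_geom_sum _ _).symm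
    rw [this, mul_pow]
    field_simp
  refine tendsto_of_tendsto_of_tendsto_of_le_of_le' hlo hhi ?_ ?_
  all_goals
    filter_upwards [self_mem_nhdsWithin] with q hq
    have hq : q < 1 := hq
    have hq' : 0 < 1 - (q : ℝ) := by simpa using hq
    have hqn : q ^ n < 1 := pow_lt_one₀ zero_le hq hn.ne'
    rw [← key q hq]
    gcongr
  · simpa using le_powerGeom e hqn
  · simpa using powerGeom_le e hqn

/-! ### Sums over decreasing tuples as nested sums -/

/-- The sum of `∏ g_i(m_i)` over all chains `n = m_1 > m_2 > ⋯ > m_s > 0`. -/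
def chain {R : Type*} [CommSemiring R] : List (ℕ → R) → ℕ → R
  | [], n => if n = 0 then 1 else 0
  | g :: gs, n => g n * ∑ n' ∈ Finset.range n, chain gs n'

/-- Strictly decreasing tuples of positive integers. -/
def IsChain {r : ℕ} (m : Fin r → ℕ) : Prop := StrictAnti m ∧ ∀ i, 0 < m i

lemma isChain_cons {r : ℕ} (n : ℕ) (m : Fin r → ℕ) :
    IsChain (Fin.cons n m : Fin (r + 1) → ℕ) ↔ Finset.univ.sup m < n ∧ IsChain m := by
  constructor
  · rintro ⟨h1, h2⟩
    have hn : 0 < n := by simpa using h2 0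
    refine ⟨(Finset.sup_lt_iff (by simpa using hn)).2 fun i _ => ?_, fun i j hij => ?_, fun i => ?_⟩
    · simpa using h1 (Fin.succ_pos i)
    · simpa using h1 (Fin.succ_lt_succ_iff.2 hij)
    · simpa using h2 i.succ
  · rintro ⟨h0, h1, h2⟩
    have hn : 0 < n := Nat.zero_lt_of_lt h0
    rw [Finset.sup_lt_iff (by simpa using hn)] at h0
    refine ⟨fun i j => ?_, fun i => ?_⟩
    · induction i using Fin.cases with
      | zero =>
        induction j using Fin.cases with
        | zero => simp
        | succ j => intro _; simpa using h0 j (Finset.mem_univ _)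
      | succ i =>
        induction j using Fin.cases with
        | zero => simp
        | succ j => intro hij; simpa using h1 (Fin.succ_lt_succ_iff.1 hij)
    · induction i using Fin.cases with
      | zero => simpa using hn
      | succ i => simpa using h2 i

-- The weight ψ on the largest entry makes the induction work: prepending n imposes ψ(k) = 1 for k <
-- n and 0 otherwise. The empty tuple has supremum 0, matching the convention that the empty chain
-- sits at 0.
open Classical in
lemma tsum_isChain_aux (r : ℕ) (g : Fin r → ℕ → ℝ≥0∞) (ψ : ℕ → ℝ≥0∞) :
    ∑' m : Fin r → ℕ, (if IsChain m then ψ (Finset.univ.sup m) * ∏ i, g i (m i) else 0) =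
      ∑' n, ψ n * chain (List.ofFn g) n := by
  induction r generalizing ψ with
  | zero =>
    rw [tsum_eq_single (default : Fin 0 → ℕ) (fun m hm => (hm (Subsingleton.elim _ _)).elim),
      tsum_eq_single 0 (fun n hn => by simp [chain, hn]), if_pos]
    · simp [chain]
    · exact ⟨fun i => i.elim0, fun i => i.elim0⟩
  | succ r ih =>
    rw [← (Fin.consEquiv fun _ : Fin (r + 1) => ℕ).tsum_eq, ENNReal.tsum_prod']
    refine tsum_congr fun n => ?_
    have h1 : ∑' k, (if k < n then (1 : ℝ≥0∞) else 0) * chain (List.ofFn fun i => g i.succ) k =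
        ∑ k ∈ Finset.range n, chain (List.ofFn fun i => g i.succ) k := by
      rw [tsum_eq_sum (s := Finset.range n)]
      · refine Finset.sum_congr rfl fun k hk => ?_
        rw [if_pos (Finset.mem_range.1 hk), one_mul]
      · intro k hk
        rw [if_neg (by simpa using hk), zero_mul]
    rw [List.ofFn_succ, chain, ← h1, ← ih, ← mul_assoc, ← ENNReal.tsum_mul_left]
    refine tsum_congr fun m => ?_
    have h2 : (Fin.consEquiv fun _ : Fin (r + 1) => ℕ) (n, m) = (Fin.cons n m : Fin (r + 1) → ℕ) :=
      rfl
    rw [h2]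
    by_cases hm : IsChain m
    · by_cases hlt : Finset.univ.sup m < n
      · rw [if_pos ((isChain_cons n m).2 ⟨hlt, hm⟩), if_pos hm, if_pos hlt]
        have h3 : Finset.univ.sup (Fin.cons n m : Fin (r + 1) → ℕ) = n := by
          rw [Fin.univ_succ, Finset.sup_cons, Finset.sup_map]
          simpa [Function.comp_def] using fun i => (Finset.le_sup (Finset.mem_univ i)).trans hlt.le
        rw [h3, Fin.prod_univ_succ]
        simp [mul_assoc]
      · rw [if_neg (fun h => hlt ((isChain_cons n m).1 h).1), if_pos hm, if_neg hlt]
        simp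
    · rw [if_neg (fun h => hm ((isChain_cons n m).1 h).2), if_neg hm, mul_zero]

open Classical in
lemma tsum_isChain {r : ℕ} (g : Fin r → ℕ → ℝ≥0∞) :
    ∑' m : {m : Fin r → ℕ // IsChain m}, ∏ i, g i (m.1 i) = ∑' n, chain (List.ofFn g) n := by
  have h := tsum_isChain_aux r g fun _ => 1
  simp only [one_mul] at h
  rw [← h]
  rw [← tsum_subtype_eq_of_support_subset (s := {m : Fin r → ℕ | IsChain m})]
  · exact tsum_congr fun m => (if_pos m.2).symm
  · intro m hm
    by_contra hc
    exact hm (if_neg hc)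

/-! ### Nested sums with integer exponents and their convergence -/

/-- The sum of `∏ m_i^{-k_i}` over all chains `n = m_1 > m_2 > ⋯ > m_s > 0`. -/
def zh : List ℤ → ℕ → ℝ
  | [], n => if n = 0 then 1 else 0
  | k :: ks, n => (n : ℝ) ^ (-k) * ∑ n' ∈ Finset.range n, zh ks n'

lemma zh_nonneg (ks : List ℤ) (n : ℕ) : 0 ≤ zh ks n := by
  induction ks generalizing n with
  | nil => rw [zh]; split_ifs <;> simp
  | cons k ks ih => rw [zh]; exact mul_nonneg (by positivity) (Finset.sum_nonneg fun i _ => ih i)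

lemma zh_zero_le_one (ks : List ℤ) : zh ks 0 ≤ 1 := by
  cases ks <;> simp [zh]

lemma ofReal_zh (ks : List ℤ) (n : ℕ) :
    ENNReal.ofReal (zh ks n) =
      chain (ks.map fun (k : ℤ) (n : ℕ) => ENNReal.ofReal ((n : ℝ) ^ (-k))) n := by
  induction ks generalizing n with
  | nil => simp only [zh, chain, List.map_nil]; split_ifs <;> simp
  | cons k ks ih =>
    simp only [zh, chain, List.map_cons]
    rw [ENNReal.ofReal_mul (by positivity), ENNReal.ofReal_sum_of_nonneg fun i _ => zh_nonneg ks i]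
    simp only [ih]

/-- All the sums `c + (k_1 - 1) + ⋯ + (k_b - 1)` with `b ≥ 1` are positive. -/
def Admissible : ℝ → List ℤ → Prop
  | _, [] => True
  | c, k :: ks => 0 < c + k - 1 ∧ Admissible (c + k - 1) ks

lemma Admissible.mono {ks : List ℤ} {c c' : ℝ} (h : Admissible c ks) (hc : c ≤ c') :
    Admissible c' ks := by
  induction ks generalizing c c' with
  | nil => trivial
  | cons k ks ih => exact ⟨by linarith [h.1], ih h.2 (by linarith)⟩

/-- `Admissible c ks` is a convergence criterion for ∑ n^{-c} `zh ks n`. The gain δ is what makes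
this series summable, and carrying it through the recursion avoids logarithms. -/
lemma Admissible.zh_le {ks : List ℤ} {c : ℝ} (h : Admissible c ks) :
    ∃ C δ : ℝ, 0 ≤ C ∧ 0 < δ ∧ ∀ n : ℕ, 0 < n → zh ks n ≤ C * (n : ℝ) ^ (c - 1 - δ) := by
  induction ks generalizing c with
  | nil =>
    refine ⟨0, 1, le_rfl, one_pos, fun n hn => ?_⟩
    simp [zh, hn.ne']
  | cons k ks ih =>
    obtain ⟨hβ, h⟩ := h
    set β : ℝ := c + k - 1 with hβd
    obtain ⟨C, δ, hC, hδ, hb⟩ := ih h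
    -- Half the minimum keeps β-η positive and η below δ: the inner terms split as i^{β-η} i^{-1-η},
    -- the first factor at most n^{β-η} and the second summable.
    set η : ℝ := min δ β / 2 with hη
    have hη0 : 0 < η := by positivity
    have hηδ : 2 * η ≤ δ := by rw [hη]; linarith [min_le_left δ β]
    have hηβ : 2 * η ≤ β := by rw [hη]; linarith [min_le_right δ β]
    have hs : Summable fun n : ℕ => (n : ℝ) ^ (-1 - η) := Real.summable_nat_rpow.2 (by linarith)
    refine ⟨1 + C * ∑' n : ℕ, (n : ℝ) ^ (-1 - η), η, ?_, hη0, fun n hn => ?_⟩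
    · exact add_nonneg zero_le_one (mul_nonneg hC (tsum_nonneg fun n => by positivity))
    have hn1 : (1 : ℝ) ≤ n := by exact_mod_cast hn
    have hn0 : (0 : ℝ) < n := by positivity
    have h1 : ∀ i ∈ Finset.range n, zh ks i ≤ (if i = 0 then 1 else 0) +
        C * (n : ℝ) ^ (β - η) * (i : ℝ) ^ (-1 - η) := by
      intro i hi
      rcases Nat.eq_zero_or_pos i with rfl | hi0
      · rw [if_pos rfl]
        have : 0 ≤ C * (n : ℝ) ^ (β - η) * ((0 : ℕ) : ℝ) ^ (-1 - η) := by positivity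
        linarith [zh_zero_le_one ks]
      · rw [if_neg hi0.ne', zero_add]
        have hi1 : (1 : ℝ) ≤ i := by exact_mod_cast hi0
        have hi0' : (0 : ℝ) < i := by positivity
        have hin : (i : ℝ) ≤ n := by exact_mod_cast (Finset.mem_range.1 hi).le
        calc zh ks i ≤ C * (i : ℝ) ^ (β - 1 - δ) := hb i hi0
          _ ≤ C * (i : ℝ) ^ ((β - η) + (-1 - η)) := by gcongr; linarith
          _ = C * ((i : ℝ) ^ (β - η) * (i : ℝ) ^ (-1 - η)) := by rw [Real.rpow_add hi0']
          _ ≤ C * ((n : ℝ) ^ (β - η) * (i : ℝ) ^ (-1 - η)) := by gcongr; linarith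
          _ = _ := by ring
    have h2 : ∑ i ∈ Finset.range n, zh ks i ≤
        (1 + C * ∑' n : ℕ, (n : ℝ) ^ (-1 - η)) * (n : ℝ) ^ (β - η) := by
      refine (Finset.sum_le_sum h1).trans ?_
      rw [Finset.sum_add_distrib, ← Finset.mul_sum, Finset.sum_ite_eq' (Finset.range n) 0,
        if_pos (Finset.mem_range.2 hn)]
      have h3 : ∑ i ∈ Finset.range n, (i : ℝ) ^ (-1 - η) ≤ ∑' n : ℕ, (n : ℝ) ^ (-1 - η) :=
        hs.sum_le_tsum _ fun i _ => by positivity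
      have h4 : (1 : ℝ) ≤ (n : ℝ) ^ (β - η) := Real.one_le_rpow hn1 (by linarith)
      have h5 : C * (n : ℝ) ^ (β - η) * ∑ i ∈ Finset.range n, (i : ℝ) ^ (-1 - η) ≤
        C * (n : ℝ) ^ (β - η) * ∑' n : ℕ, (n : ℝ) ^ (-1 - η) := by gcongr
      linarith
    calc zh (k :: ks) n = (n : ℝ) ^ (-k) * ∑ i ∈ Finset.range n, zh ks i := rfl
      _ ≤ (n : ℝ) ^ (-k) *
        ((1 + C * ∑' n : ℕ, (n : ℝ) ^ (-1 - η)) * (n : ℝ) ^ (β - η)) := by gcongr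
      _ = (1 + C * ∑' n : ℕ, (n : ℝ) ^ (-1 - η)) *
          ((n : ℝ) ^ (((-k : ℤ)) : ℝ) * (n : ℝ) ^ (β - η)) := by rw [Real.rpow_intCast]; ring
      _ = _ := by
        rw [← Real.rpow_add hn0]
        congr 2
        push_cast
        rw [hβd]
        ring

lemma Admissible.summable {ks : List ℤ} {c : ℝ} (h : Admissible c ks) :
    Summable fun n : ℕ => (n : ℝ) ^ (-c) * zh ks n := by
  obtain ⟨C, δ, hC, hδ, hb⟩ := h.zh_le
  have hs : Summable fun n : ℕ => C * ((n + 1 : ℕ) : ℝ) ^ (-1 - δ) :=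
    ((summable_nat_add_iff 1).2 (Real.summable_nat_rpow.2 (by linarith))).mul_left C
  rw [← summable_nat_add_iff 1]
  refine Summable.of_nonneg_of_le (fun n => mul_nonneg (by positivity) (zh_nonneg _ _))
    (fun n => ?_) hs
  have hn : (0 : ℝ) < ((n + 1 : ℕ) : ℝ) := by positivity
  calc ((n + 1 : ℕ) : ℝ) ^ (-c) * zh ks (n + 1)
      ≤ ((n + 1 : ℕ) : ℝ) ^ (-c) * (C * ((n + 1 : ℕ) : ℝ) ^ (c - 1 - δ)) := by
        gcongr
        exact hb _ (Nat.succ_pos n)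
    _ = C * (((n + 1 : ℕ) : ℝ) ^ (-c) * ((n + 1 : ℕ) : ℝ) ^ (c - 1 - δ)) := by ring
    _ = _ := by
      rw [← Real.rpow_add hn]
      ring_nf

lemma Admissible.summable_zh {ks : List ℤ} (h : Admissible 0 ks) : Summable (zh ks) := by
  simpa using h.summable

/-- The sum of the positive entries. -/
def weight (ks : List ℤ) : ℕ := (ks.map Int.toNat).sum

lemma weight_cons (k : ℤ) (ks : List ℤ) : weight (k :: ks) = k.toNat + weight ks := by
  simp [weight]

lemma admissible_of_pos {k : ℤ} {ks : List ℤ} (hk : 2 ≤ k) (h : ∀ i ∈ ks, 1 ≤ i) :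
    Admissible 0 (k :: ks) := by
  have key : ∀ (ks : List ℤ) (c : ℝ), 0 < c → (∀ i ∈ ks, 1 ≤ i) → Admissible c ks := by
    intro ks
    induction ks with
    | nil => intros; trivial
    | cons k ks ih =>
      intro c hc h
      have h1 : (1 : ℝ) ≤ k := by exact_mod_cast h k (by simp)
      exact ⟨by linarith, ih _ (by linarith) fun i hi => h i (by simp [hi])⟩
  have h2 : (2 : ℝ) ≤ k := by exact_mod_cast hk
  exact ⟨by linarith, key _ _ (by linarith) h⟩

lemma mzv_eq_tsum_zh {r : ℕ} (k : Fin r → ℕ) :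
    mzv k = ∑' n, zh (List.ofFn fun i => (k i : ℤ)) n := by
  have h := tsum_isChain fun (i : Fin r) (n : ℕ) => ENNReal.ofReal ((n : ℝ) ^ (-(k i : ℤ)))
  have h1 : ∀ n, chain (List.ofFn fun (i : Fin r) (n : ℕ) =>
      ENNReal.ofReal ((n : ℝ) ^ (-(k i : ℤ)))) n =
      ENNReal.ofReal (zh (List.ofFn fun i => (k i : ℤ)) n) := by
    intro n
    rw [ofReal_zh, List.map_ofFn]
    rfl
  simp only [h1] at h
  have h2 := congrArg ENNReal.toReal h
  rw [ENNReal.tsum_toReal_eq fun n => ENNReal.ofReal_ne_top,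
    ENNReal.tsum_toReal_eq fun m => ENNReal.prod_ne_top fun i _ => ENNReal.ofReal_ne_top] at h2
  simp only [ENNReal.toReal_ofReal (zh_nonneg _ _), ENNReal.toReal_prod] at h2
  rw [← h2]
  refine tsum_congr fun m => Finset.prod_congr rfl fun i _ => ?_
  rw [ENNReal.toReal_ofReal (by positivity)]
  simp

lemma exists_hasSum_of_pos {k : ℤ} {ks : List ℤ} (hk : 2 ≤ k) (h : ∀ i ∈ ks, 1 ≤ i) {w : ℕ}
    (hw : weight (k :: ks) ≤ w) : ∃ z ∈ mzvSpace w, HasSum (zh (k :: ks)) z := by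
  refine ⟨_, ?_, (admissible_of_pos hk h).summable_zh.hasSum⟩
  have hall : ∀ i ∈ k :: ks, 1 ≤ i := by
    intro i hi
    rcases List.mem_cons.1 hi with rfl | hi
    · omega
    · exact h i hi
  have hl : (List.ofFn fun i : Fin (ks.length + 1) => ((((k :: ks).get i).toNat : ℕ) : ℤ)) =
      k :: ks := by
    conv_rhs => rw [← List.ofFn_get (k :: ks)]
    congr 1
    ext i
    have := hall _ ((k :: ks).get_mem i)
    exact Int.toNat_of_nonneg (by omega)
  refine Submodule.subset_span ⟨ks.length, fun i => ((k :: ks).get i).toNat, ?_, ?_, ?_, ?_⟩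
  · change 2 ≤ k.toNat
    omega
  · intro i
    have := hall _ ((k :: ks).get_mem i)
    exact (Int.le_toNat (by omega)).2 (by exact_mod_cast this)
  · refine le_trans (le_of_eq ?_) hw
    rw [weight, ← List.sum_ofFn]
    congr 1
    conv_rhs => rw [← List.ofFn_get (k :: ks), List.map_ofFn]
    rfl
  · rw [mzv_eq_tsum_zh, hl]

/-- The operator that takes a sequence to the sequence of its partial sums. -/
def partialSum : (ℕ → ℝ) →ₗ[ℚ] (ℕ → ℝ) where
  toFun f n := ∑ i ∈ Finset.range n, f i
  map_add' f g := by ext n; simp [Finset.sum_add_distrib]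
  map_smul' c f := by ext n; simp [Finset.smul_sum]

/-- Multiplication by `n^{-k}`. -/
def divPow (k : ℤ) : (ℕ → ℝ) →ₗ[ℚ] (ℕ → ℝ) where
  toFun f n := (n : ℝ) ^ (-k) * f n
  map_add' f g := by ext n; simp [mul_add]
  map_smul' c f := by ext n; simp

lemma partialSum_apply (f : ℕ → ℝ) (n : ℕ) : partialSum f n = ∑ i ∈ Finset.range n, f i := rfl

lemma divPow_apply (k : ℤ) (f : ℕ → ℝ) (n : ℕ) : divPow k f n = (n : ℝ) ^ (-k) * f n := rfl

lemma zh_cons (k : ℤ) (ks : List ℤ) : zh (k :: ks) = divPow k (partialSum (zh ks)) := rfl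

lemma pow_mul_zh_cons (j : ℕ) (k : ℤ) (ks : List ℤ) (n : ℕ) :
    (n : ℝ) ^ j * zh (k :: ks) n = zh ((k - j) :: ks) n := by
  rcases Nat.eq_zero_or_pos n with rfl | hn
  · simp [zh]
  · have hn' : (n : ℝ) ≠ 0 := by positivity
    simp only [zh]
    rw [← mul_assoc, ← zpow_natCast, ← zpow_add₀ hn']
    ring_nf

/-- A linear map takes a span into a subspace as soon as it takes the generators there. -/
lemma map_mem_of_mem_span {M N : Type*} [AddCommGroup M] [Module ℚ M] [AddCommGroup N]
    [Module ℚ N] (L : M →ₗ[ℚ] N) {s : Set M} {p : Submodule ℚ N} (h : ∀ x ∈ s, L x ∈ p) {x : M}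
    (hx : x ∈ Submodule.span ℚ s) : L x ∈ p :=
  (Submodule.span_le (p := p.comap L)).2 h hx

/-! ### Elimination of entries `≤ 0` -/

lemma sum_range_mul_sum_range (g f : ℕ → ℝ) (n : ℕ) :
    ∑ i ∈ Finset.range n, g i * ∑ j ∈ Finset.range i, f j =
      ∑ j ∈ Finset.range n, (∑ i ∈ Finset.range n, g i - ∑ i ∈ Finset.range (j + 1), g i) * f j := by
  induction n with
  | zero => simp
  | succ n ih =>
    rw [Finset.sum_range_succ, ih, Finset.sum_range_succ _ n, sub_self, zero_mul, add_zero,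
      Finset.mul_sum, ← Finset.sum_add_distrib]
    refine Finset.sum_congr rfl fun j _ => ?_
    rw [Finset.sum_range_succ g n]
    ring

lemma exists_sum_pow_eq (a : ℕ) : ∃ c : ℕ → ℚ, ∀ n : ℕ,
    ∑ x ∈ Finset.range n, (x : ℝ) ^ a = ∑ j ∈ Finset.range (a + 2), (c j : ℝ) * (n : ℝ) ^ j := by
  refine ⟨fun j => if j = 0 then 0 else
    bernoulli (a + 1 - j) * ((a + 1).choose (a + 1 - j)) / (a + 1), fun n => ?_⟩
  have h := sum_range_pow n a
  have h2 := congrArg (Rat.cast : ℚ → ℝ) h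
  push_cast at h2
  rw [h2, Finset.sum_range_succ' _ (a + 1)]
  simp only [if_true, Rat.cast_zero, zero_mul, add_zero, Nat.succ_ne_zero, if_false]
  rw [← Finset.sum_range_reflect]
  refine Finset.sum_congr rfl fun j hj => ?_
  have hj' := Finset.mem_range.1 hj
  have h3 : a + 1 - 1 - j = a - j := by omega
  have h4 : a + 1 - (j + 1) = a - j := by omega
  have h5 : a + 1 - (a - j) = j + 1 := by omega
  rw [h3, h4, h5]
  push_cast
  ring

/-- The sequences `zh ms` with `ms` at least as good as `ks` and all entries of `ms` but the first
one positive. -/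
def betterZh (ks : List ℤ) : Set (ℕ → ℝ) :=
  {x | ∃ (k : ℤ) (ms : List ℤ), (∀ i ∈ ms, 1 ≤ i) ∧ weight (k :: ms) ≤ weight ks ∧
    (∀ c, Admissible c ks → Admissible c (k :: ms)) ∧ x = zh (k :: ms)}

lemma betterZh_mono {ks ls : List ℤ} (hw : weight ls ≤ weight ks)
    (ha : ∀ c, Admissible c ks → Admissible c ls) : betterZh ls ⊆ betterZh ks := by
  rintro x ⟨k, ms, h1, h2, h3, h4⟩
  exact ⟨k, ms, h1, h2.trans hw, fun c hc => h3 c (ha c hc), h4⟩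

/-- If k₀ = -a ≤ 0, its variable i runs strictly between its neighbours n and j, and ∑_{j<i<n} i^a =
P(n) - P(j) - j^a with P of degree a+1. These powers lower the neighbouring exponents and shorten
the list; the second may become nonpositive, whence the induction. Weight cannot grow, and c+k-1 >
a+1 keeps the new leading condition. -/
lemma zh_cons_cons_mem (ms : List ℤ) (hms : ∀ i ∈ ms, 1 ≤ i) (k k₀ : ℤ) :
    zh (k :: k₀ :: ms) ∈ Submodule.span ℚ (betterZh (k :: k₀ :: ms)) := by
  induction ms generalizing k k₀ with
  | nil =>
    by_cases hk₀ : 1 ≤ k₀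
    · exact Submodule.subset_span ⟨k, [k₀], by simpa using hk₀, le_rfl, fun c h => h, rfl⟩
    obtain ⟨a, rfl⟩ : ∃ a : ℕ, k₀ = -a := ⟨(-k₀).toNat, by omega⟩
    obtain ⟨c, hc⟩ := exists_sum_pow_eq a
    -- Only i > 0 occurs on the left, so for a = 0 the term 0^0 = 1 in Faulhaber's sum has to be
    -- removed.
    have key : zh [k, -(a : ℤ)] = ∑ j ∈ Finset.range (a + 2), c j • zh [k - j] -
        (if a = 0 then (1 : ℚ) else 0) • zh [k] := by
      ext n
      rcases Nat.eq_zero_or_pos n with rfl | hn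
      · simp [zh]
        split_ifs <;> simp
      have h0 : ∑ i ∈ Finset.range n, (i : ℝ) ^ a * ∑ j ∈ Finset.range i, zh [] j =
          ∑ i ∈ Finset.range n, (i : ℝ) ^ a - if a = 0 then 1 else 0 := by
        rw [sum_range_mul_sum_range, Finset.sum_eq_single 0]
        · simp [zh, zero_pow_eq]
        · intro j _ hj
          simp [zh, hj]
        · intro h
          exact absurd (Finset.mem_range.2 hn) h
      have h1 : zh [k, -(a : ℤ)] n = (n : ℝ) ^ (-k) *
          ∑ i ∈ Finset.range n, (i : ℝ) ^ a * ∑ j ∈ Finset.range i, zh [] j := by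
        simp only [zh, neg_neg, zpow_natCast]
      have h2 : ∀ k : ℤ, zh [k] n = (n : ℝ) ^ (-k) := by
        intro k
        simp [zh, hn]
      rw [h1, h0, hc]
      simp only [Pi.sub_apply, Finset.sum_apply, Pi.smul_apply, h2, Rat.smul_def, mul_sub,
        Finset.mul_sum]
      congr 1
      · refine Finset.sum_congr rfl fun j _ => ?_
        have hn' : (n : ℝ) ≠ 0 := by positivity
        rw [neg_sub, sub_eq_neg_add, zpow_add₀ hn', zpow_natCast]
        ring
      · split_ifs <;> simp
    have hadm : ∀ j : ℕ, j < a + 2 → zh [k - j] ∈ betterZh [k, -(a : ℤ)] := by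
      intro j hj
      refine ⟨k - j, [], by simp, ?_, ?_, rfl⟩
      · simp only [weight_cons]; omega
      · rintro c ⟨h1, h2, -⟩
        have : (j : ℝ) ≤ a + 1 := by exact_mod_cast Nat.lt_succ_iff.1 hj
        refine ⟨?_, trivial⟩
        push_cast at h2 ⊢
        linarith
    rw [key]
    refine Submodule.sub_mem _ (Submodule.sum_mem _ fun j hj => Submodule.smul_mem _ _
      (Submodule.subset_span (hadm j (Finset.mem_range.1 hj)))) (Submodule.smul_mem _ _ ?_)
    have := hadm 0 (by omega)
    simp only [Nat.cast_zero, sub_zero] at this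
    exact Submodule.subset_span this
  | cons k₂ ms ih =>
    by_cases hk₀ : 1 ≤ k₀
    · exact Submodule.subset_span ⟨k, k₀ :: k₂ :: ms, by simpa using ⟨hk₀, by simpa using hms⟩,
        le_rfl, fun c h => h, rfl⟩
    obtain ⟨a, rfl⟩ : ∃ a : ℕ, k₀ = -a := ⟨(-k₀).toNat, by omega⟩
    obtain ⟨c, hc⟩ := exists_sum_pow_eq a
    have key : zh (k :: -(a : ℤ) :: k₂ :: ms) =
        ∑ j ∈ Finset.range (a + 2), c j • zh ((k - j) :: k₂ :: ms) -
        ∑ j ∈ Finset.range (a + 2), c j • zh (k :: (k₂ - j) :: ms) -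
        zh (k :: (k₂ - a) :: ms) := by
      ext n
      rcases Nat.eq_zero_or_pos n with rfl | hn
      · simp [zh]
      have h1 : zh (k :: -(a : ℤ) :: k₂ :: ms) n = (n : ℝ) ^ (-k) *
          ∑ i ∈ Finset.range n, (i : ℝ) ^ a * ∑ j ∈ Finset.range i, zh (k₂ :: ms) j := by
        simp only [zh, neg_neg, zpow_natCast]
      have h2 : ∀ (k : ℤ) (l : List ℤ), zh (k :: l) n =
          (n : ℝ) ^ (-k) * ∑ i ∈ Finset.range n, zh l i := fun _ _ => rfl
      have h3 : ∀ i : ℕ, ∑ x ∈ Finset.range (i + 1), (x : ℝ) ^ a =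
          ∑ j ∈ Finset.range (a + 2), (c j : ℝ) * (i : ℝ) ^ j + (i : ℝ) ^ a := by
        intro i
        rw [Finset.sum_range_succ, hc]
      rw [h1, sum_range_mul_sum_range]
      simp only [Pi.sub_apply, Finset.sum_apply, Pi.smul_apply, h2 _ (_ :: _), Rat.smul_def, h3,
        hc]
      simp only [sub_mul, add_mul, Finset.sum_sub_distrib, Finset.sum_add_distrib, mul_sub, mul_add,
        pow_mul_zh_cons, Finset.sum_mul, mul_assoc]
      rw [sub_sub]
      congr 1
      · rw [← Finset.sum_comm, Finset.mul_sum]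
        refine Finset.sum_congr rfl fun j _ => ?_
        have hn' : (n : ℝ) ≠ 0 := by positivity
        rw [neg_sub, sub_eq_neg_add, zpow_add₀ hn', zpow_natCast, Finset.mul_sum, Finset.mul_sum,
          Finset.mul_sum]
        refine Finset.sum_congr rfl fun i _ => ?_
        ring
      · congr 1
        rw [Finset.sum_comm, Finset.mul_sum]
        refine Finset.sum_congr rfl fun j _ => ?_
        rw [← Finset.mul_sum]
        ring
    have hms' : ∀ i ∈ ms, 1 ≤ i := fun i hi => hms i (by simp [hi])
    have hadm : ∀ j : ℕ, j < a + 2 → zh ((k - j) :: k₂ :: ms) ∈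
        betterZh (k :: -(a : ℤ) :: k₂ :: ms) := by
      intro j hj
      refine ⟨k - j, k₂ :: ms, hms, ?_, ?_, rfl⟩
      · simp only [weight_cons]; omega
      · rintro c ⟨h1, h2, h3⟩
        have : (j : ℝ) ≤ a + 1 := by exact_mod_cast Nat.lt_succ_iff.1 hj
        push_cast at h2 h3
        refine ⟨?_, h3.mono ?_⟩ <;> push_cast <;> linarith
    have hadm' : ∀ j : ℕ, j < a + 2 → zh (k :: (k₂ - j) :: ms) ∈
        Submodule.span ℚ (betterZh (k :: -(a : ℤ) :: k₂ :: ms)) := by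
      intro j hj
      refine Submodule.span_mono (betterZh_mono ?_ ?_) (ih hms' k (k₂ - j))
      · simp only [weight_cons]; omega
      · rintro c ⟨h1, h2, h3, h4⟩
        have : (j : ℝ) ≤ a + 1 := by exact_mod_cast Nat.lt_succ_iff.1 hj
        push_cast at h2 h3 h4
        refine ⟨h1, ?_, h4.mono ?_⟩ <;> push_cast <;> linarith
    rw [key]
    exact Submodule.sub_mem _ (Submodule.sub_mem _
      (Submodule.sum_mem _ fun j hj => Submodule.smul_mem _ _
        (Submodule.subset_span (hadm j (Finset.mem_range.1 hj))))
      (Submodule.sum_mem _ fun j hj => Submodule.smul_mem _ _ (hadm' j (Finset.mem_range.1 hj))))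
      (hadm' a (by omega))

lemma zh_mem_span_betterZh (k : ℤ) (ks : List ℤ) :
    zh (k :: ks) ∈ Submodule.span ℚ (betterZh (k :: ks)) := by
  induction ks generalizing k with
  | nil => exact Submodule.subset_span ⟨k, [], by simp, le_rfl, fun c h => h, rfl⟩
  | cons k₀ ks ih =>
    rw [zh_cons]
    refine map_mem_of_mem_span ((divPow k).comp partialSum) ?_ (ih k₀)
    rintro x ⟨k', ms, h1, h2, h3, rfl⟩
    refine Submodule.span_mono (betterZh_mono ?_ ?_) (zh_cons_cons_mem ms h1 k k')
    · rw [weight_cons, weight_cons k]; omega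
    · exact fun c h => ⟨h.1, h3 _ h.2⟩

/-- The sequences whose sum lies in `mzvSpace w`. -/
def HasSumIn (w : ℕ) : Submodule ℚ (ℕ → ℝ) where
  carrier := {x | ∃ z ∈ mzvSpace w, HasSum x z}
  add_mem' := by
    rintro x y ⟨z, hz, h⟩ ⟨z', hz', h'⟩
    exact ⟨z + z', add_mem hz hz', h.add h'⟩
  zero_mem' := ⟨0, zero_mem _, hasSum_zero⟩
  smul_mem' := by
    rintro c x ⟨z, hz, h⟩
    refine ⟨c • z, Submodule.smul_mem _ _ hz, ?_⟩
    rw [Rat.smul_def]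
    exact (h.mul_left (c : ℝ)).congr_fun fun n => by rw [Pi.smul_apply, Rat.smul_def]

/-- After elimination only the first entry k' could fail to be positive, and the first admissibility
condition at c = 0 reads k' > 1, the convergence condition for multiple zeta values. -/
lemma Admissible.hasSumIn {ks : List ℤ} (h : Admissible 0 ks) (hne : ks ≠ []) {w : ℕ}
    (hw : weight ks ≤ w) : zh ks ∈ HasSumIn w := by
  cases ks with
  | nil => exact absurd rfl hne
  | cons k ks =>
    refine Submodule.span_le.2 ?_ (zh_mem_span_betterZh k ks)
    rintro x ⟨k', ms, h1, h2, h3, rfl⟩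
    have h4 := (h3 0 h).1
    have h5 : (1 : ℝ) < k' := by linarith
    exact exists_hasSum_of_pos (by exact_mod_cast h5) h1 (h2.trans hw)

/-! ### Products -/

lemma partialSum_zh_nil_mul (f : ℕ → ℝ) (n : ℕ) :
    partialSum (zh []) n * partialSum f n = partialSum f n := by
  rcases Nat.eq_zero_or_pos n with rfl | hn
  · simp [partialSum_apply]
  · simp [partialSum_apply, zh, hn]

/-- Pairs (i, j) are split into i > j, i < j and i = j. Iterated, this is the quasi-shuffle product.
-/
lemma partialSum_mul_partialSum (f g : ℕ → ℝ) :
    partialSum f * partialSum g =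
      partialSum (f * partialSum g) + partialSum (g * partialSum f) + partialSum (f * g) := by
  ext n
  simp only [Pi.mul_apply, Pi.add_apply, partialSum_apply]
  induction n with
  | zero => simp
  | succ n ih =>
    simp only [Finset.sum_range_succ, add_mul, mul_add, ih]
    ring

/-- The partial sums of `zh ms` for the lists `ms` of positive integers of weight at most `w`. -/
def posPartialSums (w : ℕ) : Set (ℕ → ℝ) :=
  {x | ∃ ms : List ℤ, (∀ i ∈ ms, 1 ≤ i) ∧ weight ms ≤ w ∧ x = partialSum (zh ms)}

lemma partialSum_divPow_mem {k : ℤ} (hk : 1 ≤ k) {w w' : ℕ} (hw : k.toNat + w ≤ w') {x : ℕ → ℝ}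
    (hx : x ∈ Submodule.span ℚ (posPartialSums w)) :
    partialSum (divPow k x) ∈ Submodule.span ℚ (posPartialSums w') := by
  refine map_mem_of_mem_span (partialSum.comp (divPow k)) ?_ hx
  rintro x ⟨ms, h1, h2, rfl⟩
  refine Submodule.subset_span ⟨k :: ms, by simpa using ⟨hk, h1⟩, ?_, rfl⟩
  rw [weight_cons]; omega

lemma zh_cons_mul (k l : ℤ) (ks ls : List ℤ) :
    zh (k :: ks) * zh (l :: ls) =
      divPow (k + l) (partialSum (zh ks) * partialSum (zh ls)) := by
  ext n
  rcases Nat.eq_zero_or_pos n with rfl | hn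
  · simp [zh, divPow_apply, partialSum_apply]
  · have hn' : (n : ℝ) ≠ 0 := by positivity
    simp only [zh_cons, divPow_apply, Pi.mul_apply]
    rw [neg_add, zpow_add₀ hn']
    ring

lemma zh_cons_mul_partialSum (k : ℤ) (ks : List ℤ) (f : ℕ → ℝ) :
    zh (k :: ks) * f = divPow k (partialSum (zh ks) * f) := by
  ext n
  simp only [zh_cons, divPow_apply, Pi.mul_apply, mul_assoc]

lemma partialSum_mul_mem (ks ls : List ℤ) (hks : ∀ i ∈ ks, 1 ≤ i) (hls : ∀ i ∈ ls, 1 ≤ i) :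
    partialSum (zh ks) * partialSum (zh ls) ∈
      Submodule.span ℚ (posPartialSums (weight ks + weight ls)) := by
  induction ks generalizing ls with
  | nil =>
    refine Submodule.subset_span ⟨ls, hls, by simp [weight], ?_⟩
    ext n
    exact partialSum_zh_nil_mul _ n
  | cons k ks ihk =>
    have hks' : ∀ i ∈ ks, 1 ≤ i := fun i hi => hks i (by simp [hi])
    induction ls with
    | nil =>
      refine Submodule.subset_span ⟨k :: ks, hks, by simp [weight], ?_⟩
      rw [mul_comm]
      ext n
      exact partialSum_zh_nil_mul _ n
    | cons l ls ihl =>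
      have hls' : ∀ i ∈ ls, 1 ≤ i := fun i hi => hls i (by simp [hi])
      have hk := hks k (by simp)
      have hl := hls l (by simp)
      rw [partialSum_mul_partialSum, zh_cons_mul, zh_cons_mul_partialSum, zh_cons_mul_partialSum]
      refine add_mem (add_mem ?_ ?_) ?_
      · refine partialSum_divPow_mem hk ?_ (ihk (l :: ls) hks' hls)
        simp only [weight_cons]; omega
      · rw [mul_comm]
        refine partialSum_divPow_mem hl ?_ (ihl hls')
        simp only [weight_cons]; omega
      · refine partialSum_divPow_mem (by omega) ?_ (ihk ls hks' hls')
        simp only [weight_cons]; omega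

lemma divPow_mem_hasSumIn {k : ℤ} (hk : 2 ≤ k) {w w' : ℕ} (hw : k.toNat + w ≤ w') {x : ℕ → ℝ}
    (hx : x ∈ Submodule.span ℚ (posPartialSums w)) : divPow k x ∈ HasSumIn w' := by
  refine map_mem_of_mem_span (divPow k) ?_ hx
  rintro x ⟨ms, h1, h2, rfl⟩
  refine exists_hasSum_of_pos hk h1 ?_
  rw [weight_cons]; omega

/-- The outermost split is made separately: its three leading entries k, l and k+l are all at least
2, so every term converges. The inner factors need only positive entries and are multiplied as
finite partial sums. -/
lemma tsum_mul_tsum_mem {k l : ℤ} {ks ls : List ℤ} (hk : 2 ≤ k) (hl : 2 ≤ l)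
    (hks : ∀ i ∈ ks, 1 ≤ i) (hls : ∀ i ∈ ls, 1 ≤ i) {w : ℕ}
    (hw : weight (k :: ks) + weight (l :: ls) ≤ w) :
    (∑' n, zh (k :: ks) n) * ∑' n, zh (l :: ls) n ∈ mzvSpace w := by
  have hks' : ∀ i ∈ k :: ks, 1 ≤ i := by
    intro i hi
    rcases List.mem_cons.1 hi with rfl | hi
    exacts [by omega, hks i hi]
  have hls' : ∀ i ∈ l :: ls, 1 ≤ i := by
    intro i hi
    rcases List.mem_cons.1 hi with rfl | hi
    exacts [by omega, hls i hi]
  simp only [weight_cons] at hw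
  have h : zh (k :: ks) * partialSum (zh (l :: ls)) + zh (l :: ls) * partialSum (zh (k :: ks)) +
      zh (k :: ks) * zh (l :: ls) ∈ HasSumIn w := by
    rw [zh_cons_mul, zh_cons_mul_partialSum, zh_cons_mul_partialSum]
    refine add_mem (add_mem ?_ ?_) ?_
    · refine divPow_mem_hasSumIn hk ?_ (partialSum_mul_mem ks (l :: ls) hks hls')
      simp only [weight_cons]; omega
    · refine divPow_mem_hasSumIn hl ?_ (partialSum_mul_mem ls (k :: ks) hls hks')
      simp only [weight_cons]; omega
    · refine divPow_mem_hasSumIn (by omega) ?_ (partialSum_mul_mem ks ls hks hls)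
      omega
  obtain ⟨z, hz, hs⟩ := h
  have h1 := hs.tendsto_sum_nat
  have h2 := ((admissible_of_pos hk hks).summable_zh.hasSum.tendsto_sum_nat).mul
    ((admissible_of_pos hl hls).summable_zh.hasSum.tendsto_sum_nat)
  have h3 : ∀ n, (∑ i ∈ Finset.range n, zh (k :: ks) i) * ∑ i ∈ Finset.range n, zh (l :: ls) i =
      ∑ i ∈ Finset.range n, (zh (k :: ks) * partialSum (zh (l :: ls)) +
        zh (l :: ls) * partialSum (zh (k :: ks)) + zh (k :: ks) * zh (l :: ls)) i := by
    intro n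
    have := congrFun (partialSum_mul_partialSum (zh (k :: ks)) (zh (l :: ls))) n
    rw [← map_add, ← map_add] at this
    exact this
  simp only [h3] at h2
  rwa [tendsto_nhds_unique h2 h1]

lemma mzv_mul_mzv_mem {r s : ℕ} {k : Fin (r + 1) → ℕ} {l : Fin (s + 1) → ℕ} (hk0 : 2 ≤ k 0)
    (hl0 : 2 ≤ l 0) (hk : ∀ i, 1 ≤ k i) (hl : ∀ i, 1 ≤ l i) {w : ℕ}
    (hw : ∑ i, k i + ∑ i, l i ≤ w) : mzv k * mzv l ∈ mzvSpace w := by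
  have hwt : ∀ {r : ℕ} (k : Fin r → ℕ), weight (List.ofFn fun i => (k i : ℤ)) = ∑ i, k i := by
    intro r k
    rw [weight, List.map_ofFn, List.sum_ofFn]
    simp
  rw [← hwt k, ← hwt l] at hw
  rw [mzv_eq_tsum_zh, mzv_eq_tsum_zh]
  rw [List.ofFn_succ, List.ofFn_succ] at *
  refine tsum_mul_tsum_mem (by exact_mod_cast hk0) (by exact_mod_cast hl0) ?_ ?_ hw
  · intro i hi
    obtain ⟨j, rfl⟩ := List.mem_ofFn.1 hi
    exact_mod_cast hk _
  · intro i hi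
    obtain ⟨j, rfl⟩ := List.mem_ofFn.1 hi
    exact_mod_cast hl _

lemma mul_mem_mzvSpace {a b : ℕ} {x y : ℝ} (hx : x ∈ mzvSpace a) (hy : y ∈ mzvSpace b) :
    x * y ∈ mzvSpace (a + b) := by
  induction hx, hy using Submodule.span_induction₂ with
  | mem_mem x y hx hy =>
    obtain ⟨r, k, hk0, hk, hkw, rfl⟩ := hx
    obtain ⟨s, l, hl0, hl, hlw, rfl⟩ := hy
    exact mzv_mul_mzv_mem hk0 hl0 hk hl (by omega)
  | zero_left y hy => simp
  | zero_right x hx => simp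
  | add_left x y z hx hy hz h1 h2 => rw [add_mul]; exact add_mem h1 h2
  | add_right x y z hx hy hz h1 h2 => rw [mul_add]; exact add_mem h1 h2
  | smul_left c x y hx hy h => rw [smul_mul_assoc]; exact Submodule.smul_mem _ _ h
  | smul_right c x y hx hy h => rw [mul_smul_comm]; exact Submodule.smul_mem _ _ h

/-! ### Block sums, their limits and their uniform bounds -/

/-- The sum of `∏ n_i^{a_i} A_{e_i}(q^{n_i}) (n_i - n_{i+1})^{b_i}` over all chains
`n = n_1 > ⋯ > n_s > n_{s+1} = 0`, where `A_e(x) = ∑_{u ≥ 1} u^e x^u`. -/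
def blockSum (q : ℝ≥0) : List (ℕ × ℕ × ℕ) → ℕ → ℝ≥0
  | [], n => if n = 0 then 1 else 0
  | (a, e, b) :: s, n => (n : ℝ≥0) ^ a * powerGeom e (q ^ n) *
      ∑ n' ∈ Finset.range n, ((n - n' : ℕ) : ℝ≥0) ^ b * blockSum q s n'

/-- The sum `blockSum` with `A_e(q^n)` replaced by its leading coefficient at `q = 1`. -/
def blockLim : List (ℕ × ℕ × ℕ) → ℕ → ℝ
  | [], n => if n = 0 then 1 else 0
  | (a, e, b) :: s, n => (n : ℝ) ^ a * (e ! / (n : ℝ) ^ (e + 1)) *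
      ∑ n' ∈ Finset.range n, ((n - n' : ℕ) : ℝ) ^ b * blockLim s n'

/-- The order of the pole of `blockSum` at `q = 1`. -/
def poleOrder (s : List (ℕ × ℕ × ℕ)) : ℕ := (s.map fun t => t.2.1 + 1).sum

/-- The effective exponents of the summand of `blockLim`. -/
def effExp (s : List (ℕ × ℕ × ℕ)) : List ℤ :=
  s.map fun t => (t.2.1 : ℤ) - t.1 - t.2.2 + 1

lemma poleOrder_cons (a e b : ℕ) (s : List (ℕ × ℕ × ℕ)) :
    poleOrder ((a, e, b) :: s) = (e + 1) + poleOrder s := by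
  simp [poleOrder]

lemma effExp_cons (a e b : ℕ) (s : List (ℕ × ℕ × ℕ)) :
    effExp ((a, e, b) :: s) = ((e : ℤ) - a - b + 1) :: effExp s := by
  simp [effExp]

lemma blockLim_nonneg (s : List (ℕ × ℕ × ℕ)) (n : ℕ) : 0 ≤ blockLim s n := by
  induction s generalizing n with
  | nil => rw [blockLim]; split_ifs <;> simp
  | cons t s ih =>
    obtain ⟨a, e, b⟩ := t
    rw [blockLim]
    exact mul_nonneg (by positivity) (Finset.sum_nonneg fun i _ => mul_nonneg (by positivity) (ih i))

lemma blockLim_length_pos (s : List (ℕ × ℕ × ℕ)) : 0 < blockLim s s.length := by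
  induction s with
  | nil => simp [blockLim]
  | cons t s ih =>
    obtain ⟨a, e, b⟩ := t
    rw [blockLim, List.length_cons]
    refine mul_pos (by positivity) (Finset.sum_pos' (fun i _ => mul_nonneg (by positivity)
      (blockLim_nonneg s i)) ⟨s.length, by simp, mul_pos ?_ ih⟩)
    rw [Nat.add_sub_cancel_left]
    positivity

lemma blockSum_cons_zero (q : ℝ≥0) (t : ℕ × ℕ × ℕ) (s : List (ℕ × ℕ × ℕ)) :
    blockSum q (t :: s) 0 = 0 := by
  simp [blockSum]

lemma coe_blockSum_cons (q : ℝ≥0) (a e b : ℕ) (s : List (ℕ × ℕ × ℕ)) (n : ℕ) :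
    (blockSum q ((a, e, b) :: s) n : ℝ) = (n : ℝ) ^ a * powerGeom e (q ^ n) *
      ∑ n' ∈ Finset.range n, ((n - n' : ℕ) : ℝ) ^ b * blockSum q s n' := by
  simp only [blockSum, NNReal.coe_mul, NNReal.coe_pow, NNReal.coe_natCast, NNReal.coe_sum]

lemma one_sub_nonneg {q : ℝ≥0} (hq : q < 1) : 0 ≤ 1 - (q : ℝ) :=
  sub_nonneg.2 (by exact_mod_cast hq.le)

lemma blockSum_le (s : List (ℕ × ℕ × ℕ)) : ∃ C : ℝ, 0 ≤ C ∧ ∀ (q : ℝ≥0) (n : ℕ), q < 1 →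
    (1 - (q : ℝ)) ^ poleOrder s * blockSum q s n ≤ C * blockLim s n := by
  induction s with
  | nil =>
    refine ⟨1, zero_le_one, fun q n _ => ?_⟩
    simp only [blockSum, blockLim, poleOrder]
    split_ifs <;> simp
  | cons t s ih =>
    obtain ⟨a, e, b⟩ := t
    obtain ⟨C, hC, h⟩ := ih
    obtain ⟨D, hD, h'⟩ := powerGeom_le_pow e
    refine ⟨D * C, by positivity, fun q n hq => ?_⟩
    have hq' := one_sub_nonneg hq
    rcases Nat.eq_zero_or_pos n with rfl | hn
    · simp [blockSum_cons_zero, blockLim]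
    calc (1 - (q : ℝ)) ^ poleOrder ((a, e, b) :: s) * blockSum q ((a, e, b) :: s) n
        = (n : ℝ) ^ a * ((1 - (q : ℝ)) ^ (e + 1) * powerGeom e (q ^ n)) *
          ∑ i ∈ Finset.range n, ((n - i : ℕ) : ℝ) ^ b *
            ((1 - (q : ℝ)) ^ poleOrder s * blockSum q s i) := by
          rw [coe_blockSum_cons, poleOrder_cons, pow_add, Finset.mul_sum, Finset.mul_sum,
            Finset.mul_sum]
          exact Finset.sum_congr rfl fun i _ => by ring
      _ ≤ (n : ℝ) ^ a * (D * (e ! / (n : ℝ) ^ (e + 1))) *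
          ∑ i ∈ Finset.range n, ((n - i : ℕ) : ℝ) ^ b * (C * blockLim s i) := by
          gcongr (n : ℝ) ^ a * ?_ * ∑ i ∈ _, _ * ?_ with i hi
          · exact h' q n hq hn
          · exact h q i hq
      _ = _ := by
          rw [blockLim, Finset.mul_sum, Finset.mul_sum, Finset.mul_sum]
          exact Finset.sum_congr rfl fun i _ => by ring

/-- The whole surplus power x of 1-q is spent on the largest variable, whose factor then gains
n^{-x}. -/
lemma blockSum_cons_le_rpow (a e b : ℕ) (s : List (ℕ × ℕ × ℕ)) {x : ℝ} (hx : 0 < x) :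
    ∃ C : ℝ, 0 ≤ C ∧ ∀ (q : ℝ≥0) (n : ℕ), q < 1 →
    (1 - (q : ℝ)) ^ (poleOrder ((a, e, b) :: s) + x) * blockSum q ((a, e, b) :: s) n ≤
      C * ((n : ℝ) ^ (-x) * blockLim ((a, e, b) :: s) n) := by
  obtain ⟨C, hC, h⟩ := blockSum_le s
  obtain ⟨D, hD, h'⟩ := powerGeom_le_rpow e (a := e + 1 + x) (by linarith)
  refine ⟨D * C / e !, by positivity, fun q n hq => ?_⟩
  have hq' : 0 < 1 - (q : ℝ) := sub_pos.2 (by exact_mod_cast hq)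
  rcases Nat.eq_zero_or_pos n with rfl | hn
  · simp [blockSum_cons_zero, blockLim]
  have hn' : (0 : ℝ) < n := by exact_mod_cast hn
  calc (1 - (q : ℝ)) ^ (poleOrder ((a, e, b) :: s) + x) * blockSum q ((a, e, b) :: s) n
      = (n : ℝ) ^ a * ((1 - (q : ℝ)) ^ (e + 1 + x) * powerGeom e (q ^ n)) *
        ∑ i ∈ Finset.range n, ((n - i : ℕ) : ℝ) ^ b *
          ((1 - (q : ℝ)) ^ poleOrder s * blockSum q s i) := by
        rw [coe_blockSum_cons, poleOrder_cons]
        have : (1 - (q : ℝ)) ^ (((e + 1 + poleOrder s : ℕ) : ℝ) + x) =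
            (1 - (q : ℝ)) ^ (e + 1 + x) * (1 - (q : ℝ)) ^ poleOrder s := by
          rw [← Real.rpow_natCast _ (poleOrder s), ← Real.rpow_add hq']
          congr 1
          push_cast
          ring
        rw [this, Finset.mul_sum, Finset.mul_sum, Finset.mul_sum]
        exact Finset.sum_congr rfl fun i _ => by ring
    _ ≤ (n : ℝ) ^ a * (D * (n : ℝ) ^ (-(e + 1 + x))) *
        ∑ i ∈ Finset.range n, ((n - i : ℕ) : ℝ) ^ b * (C * blockLim s i) := by
        gcongr (n : ℝ) ^ a * ?_ * ∑ i ∈ _, _ * ?_ with i hi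
        · exact h' q n hq hn
        · exact h q i hq
    _ = _ := by
        have : (n : ℝ) ^ (-(e + 1 + x)) = (n : ℝ) ^ (-x) / (n : ℝ) ^ (e + 1) := by
          rw [← Real.rpow_natCast, ← Real.rpow_sub hn']
          congr 1
          push_cast
          ring
        rw [this, blockLim, Finset.mul_sum, Finset.mul_sum, Finset.mul_sum, Finset.mul_sum]
        refine Finset.sum_congr rfl fun i _ => ?_
        have : (e ! : ℝ) ≠ 0 := by positivity
        field_simp

lemma tendsto_blockSum (s : List (ℕ × ℕ × ℕ)) (n : ℕ) :
    Tendsto (fun q : ℝ≥0 => (1 - (q : ℝ)) ^ poleOrder s * blockSum q s n) (𝓝[<] 1)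
      (𝓝 (blockLim s n)) := by
  induction s generalizing n with
  | nil =>
    simp only [blockSum, blockLim, poleOrder]
    split_ifs <;> simp [tendsto_const_nhds]
  | cons t s ih =>
    obtain ⟨a, e, b⟩ := t
    rcases Nat.eq_zero_or_pos n with rfl | hn
    · simp [blockSum_cons_zero, blockLim, tendsto_const_nhds]
    have h := ((tendsto_powerGeom e hn).const_mul ((n : ℝ) ^ a)).mul
      (tendsto_finsetSum (Finset.range n) fun i _ => (ih i).const_mul (((n - i : ℕ) : ℝ) ^ b))
    rw [blockLim]
    refine h.congr fun q => ?_
    rw [coe_blockSum_cons, poleOrder_cons, pow_add, Finset.mul_sum, Finset.mul_sum, Finset.mul_sum]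
    exact Finset.sum_congr rfl fun i _ => by ring

/-- The step of the recursion that defines `blockLim`. -/
def blockStep (a e b : ℕ) : (ℕ → ℝ) →ₗ[ℚ] (ℕ → ℝ) where
  toFun f n := (n : ℝ) ^ a * (e ! / (n : ℝ) ^ (e + 1)) *
      ∑ n' ∈ Finset.range n, ((n - n' : ℕ) : ℝ) ^ b * f n'
  map_add' f g := by ext n; simp [mul_add, Finset.sum_add_distrib]
  map_smul' c f := by ext n; simp [Finset.mul_sum, Rat.smul_def, mul_left_comm]

/-- Binomial expansion of (n - n')^b: the power n^x joins the outer factor and n'^{b-x} stays inside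
the partial sum. -/
lemma blockStep_eq (a e b : ℕ) (f : ℕ → ℝ) :
    blockStep a e b f = ∑ x ∈ Finset.range (b + 1), ((-1) ^ (b - x) * b.choose x * e ! : ℚ) •
      divPow (e + 1 - a - x) (partialSum fun n => (n : ℝ) ^ (b - x) * f n) := by
  ext n
  rcases Nat.eq_zero_or_pos n with rfl | hn
  · simp [blockStep, divPow_apply, partialSum_apply]
  have hn' : (n : ℝ) ≠ 0 := by positivity
  have h1 : ∀ i ∈ Finset.range n, ((n - i : ℕ) : ℝ) ^ b * f i =
      ∑ x ∈ Finset.range (b + 1), (n : ℝ) ^ x * ((-1) ^ (b - x) * (i : ℝ) ^ (b - x)) *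
        b.choose x * f i := by
    intro i hi
    rw [Nat.cast_sub (Finset.mem_range.1 hi).le, sub_eq_add_neg, add_pow, Finset.sum_mul]
    exact Finset.sum_congr rfl fun x _ => by rw [neg_pow (i : ℝ)]
  simp only [blockStep, LinearMap.coe_mk, AddHom.coe_mk, Finset.sum_apply, Pi.smul_apply,
    divPow_apply, partialSum_apply, Rat.smul_def]
  rw [Finset.sum_congr rfl h1, Finset.sum_comm, Finset.mul_sum]
  refine Finset.sum_congr rfl fun x _ => ?_
  have h2 : (n : ℝ) ^ (-((e : ℤ) + 1 - a - x)) = (n : ℝ) ^ a * (n : ℝ) ^ x / (n : ℝ) ^ (e + 1) := by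
    rw [← zpow_natCast, ← zpow_natCast, ← zpow_natCast, ← zpow_add₀ hn', ← zpow_sub₀ hn']
    congr 1
    push_cast
    ring
  rw [h2]
  simp only [Finset.mul_sum]
  refine Finset.sum_congr rfl fun i _ => ?_
  push_cast
  ring

/-- The sequences `zh ks` into which `blockLim s` can be expanded. -/
def blockZh (s : List (ℕ × ℕ × ℕ)) : Set (ℕ → ℝ) :=
  {x | ∃ ks : List ℤ, ks.length = s.length ∧ weight ks ≤ poleOrder s ∧
    (∀ c, Admissible c (effExp s) → Admissible c ks) ∧ x = zh ks}

/-- `effExp` is the extreme choice x = b in every binomial expansion. Any other choice moves powers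
from n to a smaller variable, which only relaxes admissibility and does not increase the weight
bound e+1 per entry. -/
lemma blockLim_mem_span (s : List (ℕ × ℕ × ℕ)) :
    blockLim s ∈ Submodule.span ℚ (blockZh s) := by
  induction s with
  | nil =>
    refine Submodule.subset_span ⟨[], rfl, le_rfl, fun c h => h, ?_⟩
    ext n
    simp [blockLim, zh]
  | cons t s ih =>
    obtain ⟨a, e, b⟩ := t
    refine map_mem_of_mem_span (blockStep a e b) ?_ ih
    rintro _ ⟨ks, hlen, hw, hadm, rfl⟩
    rw [blockStep_eq]
    refine Submodule.sum_mem _ fun x hx => Submodule.smul_mem _ _ ?_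
    have hxb : x ≤ b := Nat.lt_succ_iff.1 (Finset.mem_range.1 hx)
    have hxb' : (x : ℝ) ≤ b := by exact_mod_cast hxb
    cases ks with
    | nil =>
      -- With nothing below, n' = 0 is the only inner value, so only x = b survives.
      rcases hxb.lt_or_eq with hlt | rfl
      · have : (fun n : ℕ => (n : ℝ) ^ (b - x) * zh [] n) = 0 := by
          ext n
          rcases Nat.eq_zero_or_pos n with rfl | hn
          · simp [zh, (Nat.sub_pos_of_lt hlt).ne']
          · simp [zh, hn.ne']
        rw [this, map_zero, map_zero]
        exact zero_mem _
      · have : (fun n : ℕ => (n : ℝ) ^ (x - x) * zh [] n) = zh [] := by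
          ext n
          simp
        rw [this, ← zh_cons]
        refine Submodule.subset_span ⟨_, by simp [← hlen], ?_, ?_, rfl⟩
        · rw [weight_cons, poleOrder_cons]; simp only [weight, List.map_nil, List.sum_nil]; omega
        · intro c h
          rw [effExp_cons] at h
          refine ⟨?_, trivial⟩
          have := h.1
          push_cast at this ⊢
          linarith
    | cons k ks =>
      have : (fun n : ℕ => (n : ℝ) ^ (b - x) * zh (k :: ks) n) =
          zh ((k - (b - x : ℕ)) :: ks) := by
        ext n
        exact pow_mul_zh_cons _ _ _ _
      rw [this, ← zh_cons]
      refine Submodule.subset_span ⟨_, by simpa using hlen, ?_, ?_, rfl⟩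
      · rw [weight_cons] at hw
        rw [weight_cons, weight_cons, poleOrder_cons]; omega
      · intro c h
        rw [effExp_cons] at h
        obtain ⟨h1, h2⟩ := h
        obtain ⟨h3, h4⟩ := hadm _ h2
        push_cast at h1 h3 h4
        refine ⟨?_, ?_, h4.mono ?_⟩ <;> push_cast [Nat.cast_sub hxb] <;> linarith

lemma summable_blockLim {s : List (ℕ × ℕ × ℕ)} {c : ℝ} (h : Admissible c (effExp s)) :
    Summable fun n : ℕ => (n : ℝ) ^ (-c) * blockLim s n := by
  refine Submodule.span_induction (p := fun f _ => Summable fun n : ℕ => (n : ℝ) ^ (-c) * f n)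
    ?_ ?_ ?_ ?_ (blockLim_mem_span s)
  · rintro _ ⟨ks, -, -, hadm, rfl⟩
    exact (hadm c h).summable
  · simp
  · intro f g _ _ hf hg
    simpa only [Pi.add_apply, mul_add] using hf.add hg
  · intro t f _ hf
    simpa only [Pi.smul_apply, Rat.smul_def, mul_left_comm] using hf.mul_left (t : ℝ)

lemma blockLim_hasSumIn {s : List (ℕ × ℕ × ℕ)} (h : Admissible 0 (effExp s)) (hs : s ≠ []) :
    blockLim s ∈ HasSumIn (poleOrder s) := by
  refine Submodule.span_le.2 ?_ (blockLim_mem_span s)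
  rintro _ ⟨ks, hlen, hw, hadm, rfl⟩
  refine (hadm 0 h).hasSumIn ?_ hw
  rintro rfl
  exact hs (List.length_eq_zero_iff.1 hlen.symm)

/-! ### Conjugation of the large variables -/

lemma ennreal_tsum_sum_range (G : ℕ → ℕ → ℝ≥0∞) :
    ∑' m, ∑ m' ∈ Finset.range m, G m m' = ∑' m', ∑' v, G (m' + v + 1) m' := by
  have h : ∀ m, ∑ m' ∈ Finset.range m, G m m' = ∑' m', if m' < m then G m m' else 0 := by
    intro m
    rw [tsum_eq_sum (s := Finset.range m)]
    · exact Finset.sum_congr rfl fun k hk => (if_pos (Finset.mem_range.1 hk)).symm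
    · intro k hk
      exact if_neg (by simpa using hk)
  simp only [h]
  rw [ENNReal.tsum_comm]
  refine tsum_congr fun m' => ?_
  have hinj : Function.Injective fun v : ℕ => m' + v + 1 := fun a b hab => by simpa using hab
  rw [← hinj.tsum_eq]
  · exact tsum_congr fun v => if_pos (by omega)
  · intro m hm
    have : m' < m := by
      by_contra hc
      exact hm (if_neg hc)
    exact ⟨m - m' - 1, by simp only; omega⟩

lemma ennreal_powerGeom (e : ℕ) {q : ℝ≥0} (hq : q < 1) {n : ℕ} (hn : 0 < n) :
    (powerGeom e (q ^ n) : ℝ≥0∞) =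
      ∑' u : ℕ, ((u + 1 : ℕ) : ℝ≥0∞) ^ e * (q : ℝ≥0∞) ^ (n * (u + 1)) := by
  rw [powerGeom, ENNReal.coe_tsum (summable_powerGeom e (pow_lt_one₀ zero_le hq hn.ne'))]
  refine tsum_congr fun u => ?_
  push_cast
  rw [pow_mul]

lemma ennreal_blockSum_cons (q : ℝ≥0) (a e b : ℕ) (s : List (ℕ × ℕ × ℕ)) (n : ℕ) :
    (blockSum q ((a, e, b) :: s) n : ℝ≥0∞) = ∑ n' ∈ Finset.range n, (n : ℝ≥0∞) ^ a *
      powerGeom e (q ^ n) * (((n - n' : ℕ) : ℝ≥0∞) ^ b * blockSum q s n') := by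
  rw [← Finset.mul_sum]
  simp only [blockSum, ENNReal.coe_mul, ENNReal.coe_pow, ENNReal.coe_natCast,
    ENNReal.ofNNReal_finsetSum]

/-- Summation over the largest variable of the right block turns it into a variable of the left
block. -/
lemma tsum_transfer {q : ℝ≥0} (hq : q < 1) (d l D : ℕ) (R s : List (ℕ × ℕ × ℕ)) :
    ∑' m : ℕ, ∑' n : ℕ, (blockSum q ((d, l, 0) :: R) m : ℝ≥0∞) *
        ((m : ℝ≥0∞) ^ D * (q : ℝ≥0∞) ^ (m * n)) * blockSum q s n =
      ∑ e : Fin (d + D + 1), ((d + D).choose e : ℝ≥0∞) * ∑' m : ℕ, ∑' n : ℕ,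
        (blockSum q R m : ℝ≥0∞) * ((m : ℝ≥0∞) ^ (d + D - e) * (q : ℝ≥0∞) ^ (m * n)) *
          blockSum q ((0, e, l) :: s) n := by
  -- Both sides are opened into fourfold series with the weight q^{(m+v+1)(n+u+1)}. Here u+1 is the
  -- multiplicity and v+1 the gap below the variable being removed.
  have hL : ∑' m : ℕ, ∑' n : ℕ, (blockSum q ((d, l, 0) :: R) m : ℝ≥0∞) *
        ((m : ℝ≥0∞) ^ D * (q : ℝ≥0∞) ^ (m * n)) * blockSum q s n =
      ∑' m : ℕ, ∑' n : ℕ, ∑' u : ℕ, ∑' v : ℕ, (blockSum q R m : ℝ≥0∞) * blockSum q s n *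
        ((u + 1 : ℕ) : ℝ≥0∞) ^ l * ((m + v + 1 : ℕ) : ℝ≥0∞) ^ (d + D) *
        (q : ℝ≥0∞) ^ ((m + v + 1) * (n + u + 1)) := by
    have h1 : ∀ m : ℕ, ∑' n : ℕ, (blockSum q ((d, l, 0) :: R) m : ℝ≥0∞) *
        ((m : ℝ≥0∞) ^ D * (q : ℝ≥0∞) ^ (m * n)) * blockSum q s n =
        ∑ m' ∈ Finset.range m, ∑' n : ℕ, ∑' u : ℕ, (blockSum q R m' : ℝ≥0∞) * blockSum q s n *
        ((u + 1 : ℕ) : ℝ≥0∞) ^ l * (m : ℝ≥0∞) ^ (d + D) * (q : ℝ≥0∞) ^ (m * (n + u + 1)) := by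
      intro m
      rcases Nat.eq_zero_or_pos m with rfl | hm
      · simp [blockSum_cons_zero]
      rw [← Summable.tsum_finsetSum fun _ _ => ENNReal.summable]
      refine tsum_congr fun n => ?_
      rw [ennreal_blockSum_cons, ennreal_powerGeom l hq hm, mul_assoc, Finset.sum_mul]
      refine Finset.sum_congr rfl fun m' _ => ?_
      rw [← ENNReal.tsum_mul_left, ← ENNReal.tsum_mul_right, ← ENNReal.tsum_mul_right]
      refine tsum_congr fun u => ?_
      ring
    simp only [h1]
    rw [ennreal_tsum_sum_range fun m m' => ∑' n : ℕ, ∑' u : ℕ, (blockSum q R m' : ℝ≥0∞) *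
      blockSum q s n * ((u + 1 : ℕ) : ℝ≥0∞) ^ l * (m : ℝ≥0∞) ^ (d + D) *
      (q : ℝ≥0∞) ^ (m * (n + u + 1))]
    refine tsum_congr fun m => ?_
    rw [ENNReal.tsum_comm]
    refine tsum_congr fun n => ?_
    rw [ENNReal.tsum_comm]
  -- Now u+1 is the gap in the left chain and v+1 is the summation variable of A_e.
  have hR : ∀ e : ℕ, ∑' m : ℕ, ∑' n : ℕ,
      (blockSum q R m : ℝ≥0∞) * ((m : ℝ≥0∞) ^ (d + D - e) * (q : ℝ≥0∞) ^ (m * n)) *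
          blockSum q ((0, e, l) :: s) n =
      ∑' m : ℕ, ∑' n : ℕ, ∑' u : ℕ, ∑' v : ℕ, (blockSum q R m : ℝ≥0∞) * blockSum q s n *
        ((u + 1 : ℕ) : ℝ≥0∞) ^ l * ((m : ℝ≥0∞) ^ (d + D - e) * ((v + 1 : ℕ) : ℝ≥0∞) ^ e) *
        (q : ℝ≥0∞) ^ ((m + v + 1) * (n + u + 1)) := by
    intro e
    refine tsum_congr fun m => ?_
    have h1 : ∀ n : ℕ, (blockSum q R m : ℝ≥0∞) * ((m : ℝ≥0∞) ^ (d + D - e) *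
        (q : ℝ≥0∞) ^ (m * n)) * blockSum q ((0, e, l) :: s) n =
        ∑ n' ∈ Finset.range n, ∑' v : ℕ, (blockSum q R m : ℝ≥0∞) * blockSum q s n' *
        ((n - n' : ℕ) : ℝ≥0∞) ^ l * ((m : ℝ≥0∞) ^ (d + D - e) * ((v + 1 : ℕ) : ℝ≥0∞) ^ e) *
        (q : ℝ≥0∞) ^ ((m + v + 1) * n) := by
      intro n
      rcases Nat.eq_zero_or_pos n with rfl | hn
      · simp [blockSum_cons_zero]
      rw [ennreal_blockSum_cons, ennreal_powerGeom e hq hn, Finset.mul_sum]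
      refine Finset.sum_congr rfl fun n' _ => ?_
      rw [← ENNReal.tsum_mul_left, ← ENNReal.tsum_mul_right, ← ENNReal.tsum_mul_left]
      refine tsum_congr fun v => ?_
      ring
    simp only [h1]
    rw [ennreal_tsum_sum_range fun n n' => ∑' v : ℕ, (blockSum q R m : ℝ≥0∞) * blockSum q s n' *
        ((n - n' : ℕ) : ℝ≥0∞) ^ l * ((m : ℝ≥0∞) ^ (d + D - e) * ((v + 1 : ℕ) : ℝ≥0∞) ^ e) *
        (q : ℝ≥0∞) ^ ((m + v + 1) * n)]
    refine tsum_congr fun n => tsum_congr fun u => ?_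
    rw [show n + u + 1 - n = u + 1 by omega]
  rw [hL]
  simp only [hR, ← ENNReal.tsum_mul_left]
  simp only [← Summable.tsum_finsetSum fun _ _ => ENNReal.summable]
  refine tsum_congr fun m => tsum_congr fun n => tsum_congr fun u => tsum_congr fun v => ?_
  have h2 : ((m + v + 1 : ℕ) : ℝ≥0∞) ^ (d + D) = ∑ e : Fin (d + D + 1),
      ((v + 1 : ℕ) : ℝ≥0∞) ^ (e : ℕ) * (m : ℝ≥0∞) ^ (d + D - e) * ((d + D).choose e : ℝ≥0∞) := by
    rw [show m + v + 1 = (v + 1) + m by ring, Nat.cast_add, add_pow, Finset.sum_range]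
  rw [h2, Finset.mul_sum, Finset.sum_mul]
  exact Finset.sum_congr rfl fun e _ => by ring

/-- The blocks of the original sum. -/
def toBlocks (L : List (ℕ × ℕ)) : List (ℕ × ℕ × ℕ) := L.map fun t => (t.1, t.2, 0)

/-- The expansion of the full sum, in which the variables in `rl` (listed from the smallest one)
are summed first. -/
structure Expansion (rl : List (ℕ × ℕ)) where
  ι : Type
  [fin : Fintype ι]
  c : ι → ℕ
  D : ι → ℕ
  s : ι → List (ℕ × ℕ × ℕ)
  c_pos : ∀ i, 0 < c i
  -- For a nonempty left block, n is the total multiplicity of the transferred variables, and m is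
  -- the largest variable of a nonempty R.
  tsum_eq : ∀ q : ℝ≥0, q < 1 → ∀ R : List (ℕ × ℕ × ℕ),
    ∑' m, (blockSum q (toBlocks rl.reverse ++ R) m : ℝ≥0∞) =
      ∑ i, (c i : ℝ≥0∞) * ∑' m : ℕ, ∑' n : ℕ, (blockSum q R m : ℝ≥0∞) *
        ((m : ℝ≥0∞) ^ D i * (q : ℝ≥0∞) ^ (m * n)) * blockSum q (s i) n
  poleOrder_add : ∀ i, poleOrder (s i) + D i = (rl.map fun t => t.1 + 1).sum
  length_eq : ∀ i, (s i).length = rl.length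
  -- The shift by D accounts for the factor n^{-D} that the coupling m^D q^{mn} yields in the
  -- majorant.
  admissible : ∀ i c, Admissible c (rl.map fun t => (t.1 : ℤ) - t.2 + 1) →
    Admissible (c + D i) (effExp (s i))
  exists_D_eq_zero : ∃ i, D i = 0

attribute [instance] Expansion.fin

/-- The trivial expansion. -/
def Expansion.nil : Expansion [] where
  ι := Unit
  c _ := 1
  D _ := 0
  s _ := []
  c_pos _ := one_pos
  tsum_eq q hq R := by
    simp only [toBlocks, List.reverse_nil, List.map_nil, List.nil_append, Finset.univ_unique,
      Finset.sum_singleton, Nat.cast_one, one_mul, pow_zero]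
    refine tsum_congr fun m => ?_
    rw [tsum_eq_single 0]
    · simp [blockSum]
    · intro n hn
      simp [blockSum, hn]
  poleOrder_add _ := rfl
  length_eq _ := rfl
  admissible _ _ _ := trivial
  exists_D_eq_zero := ⟨(), rfl⟩

/-- The expansion for one more variable. -/
def Expansion.cons (d l : ℕ) {rl : List (ℕ × ℕ)} (E : Expansion rl) :
    Expansion ((d, l) :: rl) where
  ι := Σ i : E.ι, Fin (d + E.D i + 1)
  c x := E.c x.1 * (d + E.D x.1).choose x.2
  D x := d + E.D x.1 - x.2
  s x := (0, (x.2 : ℕ), l) :: E.s x.1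
  c_pos x := Nat.mul_pos (E.c_pos _) (Nat.choose_pos (Nat.lt_succ_iff.1 x.2.2))
  tsum_eq q hq R := by
    have h := E.tsum_eq q hq ((d, l, 0) :: R)
    have h1 : toBlocks ((d, l) :: rl).reverse ++ R =
        toBlocks rl.reverse ++ ((d, l, 0) :: R) := by
      simp [toBlocks]
    rw [h1, h, Fintype.sum_sigma]
    refine Finset.sum_congr rfl fun i _ => ?_
    rw [tsum_transfer hq, Finset.mul_sum]
    refine Finset.sum_congr rfl fun e _ => ?_
    push_cast
    rw [mul_assoc]
  poleOrder_add x := by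
    have := E.poleOrder_add x.1
    have := x.2.2
    rw [poleOrder_cons, List.map_cons, List.sum_cons]
    omega
  length_eq x := by simp [E.length_eq]
  admissible x c h := by
    rw [List.map_cons] at h
    obtain ⟨h1, h2⟩ := h
    have h3 := E.admissible x.1 _ h2
    have h4 : ((x.2 : ℕ) : ℝ) ≤ d + E.D x.1 := by exact_mod_cast Nat.lt_succ_iff.1 x.2.2
    have h5 : ((d + E.D x.1 - x.2 : ℕ) : ℝ) = d + E.D x.1 - (x.2 : ℕ) := by
      rw [Nat.cast_sub (Nat.lt_succ_iff.1 x.2.2)]; push_cast; ring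
    rw [effExp_cons, h5]
    push_cast at h1 h3
    have h6 : (0 : ℝ) ≤ E.D x.1 := by positivity
    -- The new D plus e equals d + `E.D x.1`, so the next constant is c + d - l + `E.D x.1`, exactly
    -- the one in `h3`.
    refine ⟨?_, h3.mono ?_⟩ <;> push_cast <;> linarith
  exists_D_eq_zero := by
    obtain ⟨i, hi⟩ := E.exists_D_eq_zero
    exact ⟨⟨i, Fin.last _⟩, by simp⟩

/-- The expansion for a list of variables. -/
def expansion : (rl : List (ℕ × ℕ)) → Expansion rl
  | [] => Expansion.nil
  | (d, l) :: rl => Expansion.cons d l (expansion rl)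

/-! ### The multiple sum over decreasing tuples -/

lemma prod_tsum_fin (r : ℕ) (g : Fin r → ℕ → ℝ≥0∞) :
    ∏ i, ∑' u, g i u = ∑' s : Fin r → ℕ, ∏ i, g i (s i) := by
  induction r with
  | zero =>
    rw [tsum_eq_single (default : Fin 0 → ℕ) (fun m hm => (hm (Subsingleton.elim _ _)).elim)]
    simp
  | succ r ih =>
    rw [← (Fin.consEquiv fun _ : Fin (r + 1) => ℕ).tsum_eq, ENNReal.tsum_prod', Fin.prod_univ_succ,
      ih, ← ENNReal.tsum_mul_right]
    refine tsum_congr fun u => ?_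
    rw [← ENNReal.tsum_mul_left]
    refine tsum_congr fun s => ?_
    rw [Fin.prod_univ_succ]
    rfl

/-- The summand `s^l x^s` of the power series `∑_{s ≥ 1} s^l x^s`. -/
def powerGeomTerm (l : ℕ) (x : ℝ≥0∞) (s : ℕ) : ℝ≥0∞ := if 0 < s then (s : ℝ≥0∞) ^ l * x ^ s else 0

lemma tsum_powerGeomTerm (l : ℕ) {q : ℝ≥0} (hq : q < 1) {n : ℕ} (hn : 0 < n) :
    ∑' s, powerGeomTerm l ((q : ℝ≥0∞) ^ n) s = powerGeom l (q ^ n) := by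
  rw [ennreal_powerGeom l hq hn, tsum_eq_zero_add' ENNReal.summable]
  simp [powerGeomTerm, pow_mul]

lemma chain_eq_blockSum {q : ℝ≥0} (L : List (ℕ × ℕ)) (n : ℕ) :
    chain (L.map fun t (n : ℕ) => (n : ℝ≥0∞) ^ t.1 * (powerGeom t.2 (q ^ n) : ℝ≥0∞)) n =
      blockSum q (toBlocks L) n := by
  induction L generalizing n with
  | nil =>
    simp only [chain, toBlocks, List.map_nil, blockSum]
    split_ifs <;> simp
  | cons t L ih =>
    simp only [List.map_cons, chain, ih, toBlocks, ennreal_blockSum_cons, pow_zero, one_mul,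
      Finset.mul_sum]

lemma tsum_tuples_eq {q : ℝ≥0} (hq : q < 1) {r : ℕ} (d l : Fin r → ℕ) :
    ∑' m : {m : Fin r → ℕ // IsChain m}, ∑' s : Fin r → ℕ,
        ∏ i, ((m.1 i : ℝ≥0∞) ^ d i * powerGeomTerm (l i) ((q : ℝ≥0∞) ^ m.1 i) (s i)) =
      ∑' n, (blockSum q (toBlocks (List.ofFn fun i => (d i, l i))) n : ℝ≥0∞) := by
  simp only [← chain_eq_blockSum, List.map_ofFn]
  rw [← tsum_isChain]
  refine tsum_congr fun m => ?_
  rw [← prod_tsum_fin r fun i s =>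
    (m.1 i : ℝ≥0∞) ^ d i * powerGeomTerm (l i) ((q : ℝ≥0∞) ^ m.1 i) s]
  refine Finset.prod_congr rfl fun i _ => ?_
  rw [ENNReal.tsum_mul_left, tsum_powerGeomTerm _ hq (m.2.2 i)]
  rfl

/-! ### The bracket as a sum over tuples -/

/-- The multiset with `s_i` copies of `m_i` for each `i`. -/
def tupleParts {r : ℕ} (x : (Fin r → ℕ) × (Fin r → ℕ)) : Multiset ℕ :=
  ∑ i, Multiset.replicate (x.2 i) (x.1 i)

/-- The sum of all `m_i s_i`. -/
def tupleSize {r : ℕ} (x : (Fin r → ℕ) × (Fin r → ℕ)) : ℕ := ∑ i, x.1 i * x.2 i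

lemma sum_tupleParts {r : ℕ} (x : (Fin r → ℕ) × (Fin r → ℕ)) :
    (tupleParts x).sum = tupleSize x := by
  rw [tupleParts, tupleSize, ← Multiset.coe_sumAddMonoidHom, map_sum]
  refine Finset.sum_congr rfl fun i _ => ?_
  rw [Multiset.coe_sumAddMonoidHom, Multiset.sum_replicate, smul_eq_mul, mul_comm]

lemma tupleParts_le_iff {r : ℕ} {x : (Fin r → ℕ) × (Fin r → ℕ)} (hx : StrictAnti x.1)
    (S : Multiset ℕ) : tupleParts x ≤ S ↔ ∀ i, x.2 i ≤ S.count (x.1 i) := by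
  have hc : ∀ a, (tupleParts x).count a = ∑ i, if x.1 i = a then x.2 i else 0 := by
    intro a
    rw [tupleParts, Multiset.count_sum']
    simp only [Multiset.count_replicate]
  have hc' : ∀ i, (tupleParts x).count (x.1 i) = x.2 i := by
    intro i
    rw [hc, Finset.sum_eq_single i]
    · simp
    · intro j _ hj
      exact if_neg fun h => hj (hx.injective h)
    · simp
  rw [Multiset.le_iff_count]
  constructor
  · intro h i
    rw [← hc' i]
    exact h _
  · intro h a
    by_cases ha : ∃ i, x.1 i = a
    · obtain ⟨i, rfl⟩ := ha
      rw [hc']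
      exact h i
    · rw [hc, Finset.sum_eq_zero]
      · exact Nat.zero_le _
      · intro i _
        exact if_neg fun h => ha ⟨i, h⟩

open Classical in
/-- The pairs of a decreasing tuple `m` and a tuple `s` of positive integers with
`∑ m_i s_i = k`. -/
def tupleFiber (r k : ℕ) : Finset ((Fin r → ℕ) × (Fin r → ℕ)) :=
  ((Fintype.piFinset fun _ => Finset.Icc 1 k) ×ˢ (Fintype.piFinset fun _ => Finset.Icc 1 k)).filter
    fun x => (IsChain x.1 ∧ ∀ i, 0 < x.2 i) ∧ tupleSize x = k

open Classical in
lemma mem_tupleFiber {r k : ℕ} {x : (Fin r → ℕ) × (Fin r → ℕ)} :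
    x ∈ tupleFiber r k ↔ (IsChain x.1 ∧ ∀ i, 0 < x.2 i) ∧ tupleSize x = k := by
  rw [tupleFiber, Finset.mem_filter, and_iff_right_iff_imp]
  rintro ⟨⟨⟨-, h1⟩, h2⟩, rfl⟩
  have h3 : ∀ i, x.1 i * x.2 i ≤ tupleSize x := fun i =>
    Finset.single_le_sum (f := fun i => x.1 i * x.2 i) (fun _ _ => Nat.zero_le _)
      (Finset.mem_univ i)
  simp only [Finset.mem_product, Fintype.mem_piFinset, Finset.mem_Icc]
  exact ⟨fun i => ⟨h1 i, (Nat.le_mul_of_pos_right _ (h2 i)).trans (h3 i)⟩,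
    fun i => ⟨h2 i, (Nat.le_mul_of_pos_left _ (h1 i)).trans (h3 i)⟩⟩

/-- The monomial `∏ m_i^{d_i} s_i^{l_i}`. -/
def tupleVal {r : ℕ} (d l : Fin r → ℕ) (x : (Fin r → ℕ) × (Fin r → ℕ)) : ℕ :=
  ∏ i, x.1 i ^ d i * x.2 i ^ l i

-- The bounds s_i ≤ r_{m_i}(λ) say that λ contains the multiset of s_i copies of each m_i. Sorting
-- by its size k prepares the convolution with the partition numbers.
open Classical in
lemma psi_monom_eq {r : ℕ} (d l : Fin r → ℕ) (N : ℕ) (lam : N.Partition) :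
    Psi (monom d l) ⟨N, lam⟩ = ∑ k ∈ Finset.range (N + 1),
      ∑ x ∈ tupleFiber r k, if tupleParts x ≤ lam.parts then (tupleVal d l x : ℚ) else 0 := by
  have hv : ∀ m s : Fin r → ℕ, MvPolynomial.eval
      (Sum.elim (fun i => (m i : ℚ)) (fun i => (s i : ℚ))) (monom d l) = tupleVal d l (m, s) := by
    intro m s
    simp [monom, tupleVal]
  simp only [Psi, hv, mult, ← Finset.sum_filter]
  rw [Finset.sum_sigma', Finset.sum_sigma']
  refine Finset.sum_nbij' (fun y => ⟨tupleSize (y.1, y.2), (y.1, y.2)⟩) (fun y => ⟨y.2.1, y.2.2⟩)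
    ?_ ?_ ?_ ?_ ?_
  · rintro ⟨m, s⟩ h
    simp only [Finset.mem_sigma, Finset.mem_filter, Fintype.mem_piFinset, Finset.mem_Icc] at h
    obtain ⟨⟨h1, h2⟩, h3⟩ := h
    have h4 : tupleParts (m, s) ≤ lam.parts := (tupleParts_le_iff h2 _).2 fun i => (h3 i).2
    have h5 : tupleSize (m, s) ≤ N := by
      rw [← sum_tupleParts]
      obtain ⟨u, hu⟩ := Multiset.le_iff_exists_add.1 h4
      have := lam.parts_sum
      rw [hu, Multiset.sum_add] at this
      omega
    simp only [Finset.mem_sigma, Finset.mem_filter, Finset.mem_range, mem_tupleFiber]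
    exact ⟨by omega, ⟨⟨⟨h2, fun i => (h1 i).1⟩, fun i => (h3 i).1⟩, trivial⟩, h4⟩
  · rintro ⟨k, m, s⟩ h
    simp only [Finset.mem_sigma, Finset.mem_filter, Finset.mem_range, mem_tupleFiber] at h
    obtain ⟨h1, ⟨⟨⟨h2, h3⟩, h4⟩, h5⟩, h6⟩ := h
    have h7 := (tupleParts_le_iff (x := (m, s)) h2 _).1 h6
    simp only [Finset.mem_sigma, Finset.mem_filter, Fintype.mem_piFinset, Finset.mem_Icc]
    refine ⟨⟨fun i => ⟨h3 i, ?_⟩, h2⟩, fun i => ⟨h4 i, h7 i⟩⟩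
    have h8 : m i ∈ lam.parts := Multiset.count_pos.1 ((h4 i).trans_le (h7 i))
    exact (Multiset.le_sum_of_mem h8).trans_eq lam.parts_sum
  · rintro ⟨m, s⟩ h
    rfl
  · rintro ⟨k, m, s⟩ h
    simp only [Finset.mem_sigma, Finset.mem_filter, Finset.mem_range, mem_tupleFiber] at h
    rw [h.2.1.2]
  · rintro ⟨m, s⟩ h
    rfl

open Classical in
/-- Removing a fixed multiset of parts from partitions. -/
lemma card_partition_filter (k k' : ℕ) {M : Multiset ℕ} (hM : ∀ a ∈ M, 0 < a) (hk : M.sum = k) :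
    (Finset.univ.filter fun lam : (k + k').Partition => M ≤ lam.parts).card =
      Fintype.card k'.Partition := by
  rw [← Finset.card_univ]
  symm
  refine Finset.card_bij (fun mu _ => ⟨M + mu.parts, ?_, ?_⟩) ?_ ?_ ?_
  · intro a ha
    rcases Multiset.mem_add.1 ha with ha | ha
    exacts [hM a ha, mu.parts_pos ha]
  · rw [Multiset.sum_add, hk, mu.parts_sum]
  · intro mu _
    simp
  · intro mu _ nu _ h
    have := congrArg Nat.Partition.parts h
    exact Nat.Partition.ext (by simpa using this)
  · intro lam hlam
    obtain ⟨u, hu⟩ := Multiset.le_iff_exists_add.1 (Finset.mem_filter.1 hlam).2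
    refine ⟨⟨u, fun {a} ha => lam.parts_pos (by rw [hu]; exact Multiset.mem_add.2 (Or.inr ha)), ?_⟩,
      Finset.mem_univ _, Nat.Partition.ext hu.symm⟩
    have := lam.parts_sum
    rw [hu, Multiset.sum_add, hk] at this
    omega

lemma pos_of_mem_tupleParts {r : ℕ} {x : (Fin r → ℕ) × (Fin r → ℕ)} (hx : ∀ i, 0 < x.1 i) :
    ∀ a ∈ tupleParts x, 0 < a := by
  intro a ha
  obtain ⟨i, -, hi⟩ := Multiset.mem_sum.1 ha
  rw [Multiset.eq_of_mem_replicate hi]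
  exact hx i

-- For a fixed tuple of size k, the partitions of N containing its multiset correspond to all
-- partitions of N-k, so the partition series factors out.
open Classical in
lemma genSeries_psi {r : ℕ} (d l : Fin r → ℕ) :
    genSeries (Psi (monom d l)) =
      (PowerSeries.mk fun k => ∑ x ∈ tupleFiber r k, (tupleVal d l x : ℚ)) *
        genSeries fun _ => 1 := by
  ext N
  rw [PowerSeries.coeff_mul, Finset.Nat.sum_antidiagonal_eq_sum_range_succ_mk]
  simp only [genSeries, PowerSeries.coeff_mk, psi_monom_eq]
  rw [Finset.sum_comm]
  refine Finset.sum_congr rfl fun k hk => ?_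
  obtain ⟨k', rfl⟩ := Nat.exists_eq_add_of_le (Nat.lt_succ_iff.1 (Finset.mem_range.1 hk))
  rw [Finset.sum_comm, Finset.sum_mul]
  refine Finset.sum_congr rfl fun x hx => ?_
  obtain ⟨⟨⟨-, h1⟩, -⟩, h2⟩ := mem_tupleFiber.1 hx
  have h3 := card_partition_filter k k' (pos_of_mem_tupleParts h1)
    ((sum_tupleParts x).trans h2)
  rw [← Finset.sum_filter, Finset.sum_const, h3, Nat.add_sub_cancel_left, nsmul_eq_mul, mul_comm]
  simp

lemma qBracket_psi {r : ℕ} (d l : Fin r → ℕ) :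
    qBracket (Psi (monom d l)) =
      PowerSeries.mk fun k => ∑ x ∈ tupleFiber r k, (tupleVal d l x : ℚ) := by
  rw [qBracket, genSeries_psi, mul_assoc, PowerSeries.mul_inv_cancel, mul_one]
  rw [← PowerSeries.coeff_zero_eq_constantCoeff_apply, genSeries, PowerSeries.coeff_mk]
  simp

lemma qBracketTerm_psi {r : ℕ} (d l : Fin r → ℕ) (q : ℝ) (k : ℕ) :
    qBracketTerm (Psi (monom d l)) q k =
      ∑ x ∈ tupleFiber r k, (tupleVal d l x : ℝ) * q ^ tupleSize x := by
  rw [qBracketTerm, qBracket_psi, PowerSeries.coeff_mk, Rat.cast_sum, Finset.sum_mul]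
  refine Finset.sum_congr rfl fun x hx => ?_
  rw [(mem_tupleFiber.1 hx).2]
  simp

lemma qBracketTerm_nonneg {r : ℕ} (d l : Fin r → ℕ) (q : ℝ≥0) (k : ℕ) :
    0 ≤ qBracketTerm (Psi (monom d l)) q k := by
  rw [qBracketTerm_psi]
  exact Finset.sum_nonneg fun x _ => by positivity

open Classical in
lemma tsum_qBracketTerm {q : ℝ≥0} (hq : q < 1) {r : ℕ} (d l : Fin r → ℕ) :
    ∑' k, ENNReal.ofReal (qBracketTerm (Psi (monom d l)) q k) =
      ∑' n, (blockSum q (toBlocks (List.ofFn fun i => (d i, l i))) n : ℝ≥0∞) := by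
  have h1 : ∀ k, ENNReal.ofReal (qBracketTerm (Psi (monom d l)) q k) =
      ∑' x : (Fin r → ℕ) × (Fin r → ℕ), if tupleSize x = k then
        (if IsChain x.1 ∧ ∀ i, 0 < x.2 i then
          (tupleVal d l x : ℝ≥0∞) * (q : ℝ≥0∞) ^ tupleSize x else 0) else 0 := by
    intro k
    rw [qBracketTerm_psi, ENNReal.ofReal_sum_of_nonneg fun x _ => by positivity,
      tsum_eq_sum (s := tupleFiber r k)]
    · refine Finset.sum_congr rfl fun x hx => ?_
      obtain ⟨h1, h2⟩ := mem_tupleFiber.1 hx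
      rw [if_pos h2, if_pos h1, ENNReal.ofReal_mul (by positivity), ENNReal.ofReal_natCast,
        ENNReal.ofReal_pow (by positivity), ENNReal.ofReal_coe_nnreal]
    · intro x hx
      rw [mem_tupleFiber, not_and'] at hx
      split_ifs with h2 h3
      · exact absurd h3 (hx h2)
      · rfl
      · rfl
  simp only [h1]
  rw [ENNReal.tsum_comm, ← tsum_tuples_eq hq, ENNReal.tsum_prod']
  simp only [tsum_ite_eq']
  rw [← tsum_subtype_eq_of_support_subset (s := {m : Fin r → ℕ | IsChain m})]
  · refine tsum_congr fun m => tsum_congr fun s => ?_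
    have hm : IsChain m.1 := m.2
    by_cases hs : ∀ i, 0 < s i
    · rw [if_pos ⟨hm, hs⟩, tupleVal, tupleSize, ← Finset.prod_pow_eq_pow_sum, Nat.cast_prod,
        ← Finset.prod_mul_distrib]
      refine Finset.prod_congr rfl fun i _ => ?_
      rw [powerGeomTerm, if_pos (hs i), pow_mul]
      push_cast
      ring
    · rw [if_neg fun h => hs h.2]
      push Not at hs
      obtain ⟨i, hi⟩ := hs
      refine (Finset.prod_eq_zero (Finset.mem_univ i) ?_).symm
      rw [powerGeomTerm, if_neg (by omega), mul_zero]
  · intro m hm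
    by_contra hc
    refine hm ?_
    simp only [ENNReal.tsum_eq_zero]
    exact fun s => if_neg fun h => hc h.1

/-! ### The asymptotics of the expansion -/

/-- The summand of an expansion. -/
def expTerm (R s : List (ℕ × ℕ × ℕ)) (D : ℕ) (q : ℝ≥0) (p : ℕ × ℕ) : ℝ≥0 :=
  blockSum q R p.1 * ((p.1 : ℝ≥0) ^ D * q ^ (p.1 * p.2)) * blockSum q s p.2

lemma Expansion.tsum_eq_tsum_expTerm {rl : List (ℕ × ℕ)} (E : Expansion rl) {q : ℝ≥0} (hq : q < 1)
    (R : List (ℕ × ℕ × ℕ)) :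
    ∑' m, (blockSum q (toBlocks rl.reverse ++ R) m : ℝ≥0∞) =
      ∑ i, (E.c i : ℝ≥0∞) * ∑' p, (expTerm R (E.s i) (E.D i) q p : ℝ≥0∞) := by
  rw [E.tsum_eq q hq R]
  refine Finset.sum_congr rfl fun i _ => ?_
  rw [ENNReal.tsum_prod']
  simp only [expTerm, ENNReal.coe_mul, ENNReal.coe_pow, ENNReal.coe_natCast]

lemma tendsto_one_sub_pow (D : ℕ) :
    Tendsto (fun q : ℝ≥0 => (1 - (q : ℝ)) ^ D) (𝓝[<] 1) (𝓝 (if D = 0 then 1 else 0)) := by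
  have h := ((tendsto_const_nhds (x := (1 : ℝ))).sub tendsto_coe_one).pow D
  rwa [sub_self, zero_pow_eq] at h

lemma tendsto_expTerm (R s : List (ℕ × ℕ × ℕ)) (D : ℕ) (p : ℕ × ℕ) :
    Tendsto (fun q : ℝ≥0 => (1 - (q : ℝ)) ^ (poleOrder s + D + poleOrder R) * expTerm R s D q p)
      (𝓝[<] 1) (𝓝 ((if D = 0 then 1 else 0) * (blockLim R p.1 * blockLim s p.2))) := by
  have h1 : Tendsto (fun q : ℝ≥0 => (1 - (q : ℝ)) ^ D * ((p.1 : ℝ) ^ D * (q : ℝ) ^ (p.1 * p.2)))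
      (𝓝[<] 1) (𝓝 (if D = 0 then 1 else 0)) := by
    have h := (tendsto_one_sub_pow D).mul
      ((tendsto_coe_one.pow (p.1 * p.2)).const_mul ((p.1 : ℝ) ^ D))
    convert h using 2
    split_ifs with hD
    · simp [hD]
    · simp
  have h2 := h1.mul ((tendsto_blockSum R p.1).mul (tendsto_blockSum s p.2))
  refine h2.congr fun q => ?_
  simp only [expTerm, NNReal.coe_mul, NNReal.coe_pow, NNReal.coe_natCast]
  ring

/-- The estimate (mn(1-q))^D e^{-mn(1-q)} ≤ D^D bounds the scaled coupling by D^D n^{-D},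
independently of m, so the majorant is a product of a function of m and one of n. -/
lemma expTerm_le (R s : List (ℕ × ℕ × ℕ)) {D : ℕ} (hsD : s = [] → D = 0) :
    ∃ C : ℝ, 0 ≤ C ∧ ∀ (q : ℝ≥0) (p : ℕ × ℕ), q < 1 →
      (1 - (q : ℝ)) ^ (poleOrder s + D + poleOrder R) * expTerm R s D q p ≤
        C * (blockLim R p.1 * ((p.2 : ℝ) ^ (-(D : ℝ)) * blockLim s p.2)) := by
  obtain ⟨C₁, hC₁, h₁⟩ := blockSum_le R
  obtain ⟨C₂, hC₂, h₂⟩ := blockSum_le s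
  refine ⟨C₁ * (D : ℝ) ^ D * C₂, by positivity, fun q ⟨m, n⟩ hq => ?_⟩
  have hq' := one_sub_nonneg hq
  have hR := blockLim_nonneg R m
  have hs := blockLim_nonneg s n
  have h0 : (1 - (q : ℝ)) ^ (poleOrder s + D + poleOrder R) * expTerm R s D q (m, n) =
      ((1 - (q : ℝ)) ^ poleOrder R * blockSum q R m) *
      ((1 - (q : ℝ)) ^ D * ((m : ℝ) ^ D * (q : ℝ) ^ (m * n))) *
      ((1 - (q : ℝ)) ^ poleOrder s * blockSum q s n) := by
    simp only [expTerm, NNReal.coe_mul, NNReal.coe_pow, NNReal.coe_natCast]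
    ring
  by_cases hz : n = 0 ∧ s ≠ []
  · obtain ⟨rfl, hz⟩ := hz
    obtain ⟨t, s, rfl⟩ := List.exists_cons_of_ne_nil hz
    rw [h0, blockSum_cons_zero]
    simp only [NNReal.coe_zero, mul_zero]
    positivity
  have h3 : (1 - (q : ℝ)) ^ D * ((m : ℝ) ^ D * (q : ℝ) ^ (m * n)) ≤
      (D : ℝ) ^ D * (n : ℝ) ^ (-(D : ℝ)) := by
    -- At n = 0 the real power 0^{-D} is 0 unless D = 0; this is where an empty left block must have
    -- D = 0.
    rcases Nat.eq_zero_or_pos n with rfl | hn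
    · have : D = 0 := hsD (by simpa using hz)
      subst this
      simp
    · have hn' : (0 : ℝ) < n := by exact_mod_cast hn
      have h4 := rpow_mul_exp_neg_le (b := D) (y := m * n * (1 - q)) (by positivity) (by positivity)
      have h5 := pow_le_exp_neg (q := q) (m * n)
      push_cast at h5
      rw [Real.rpow_natCast, Real.rpow_natCast] at h4
      rw [Real.rpow_neg hn'.le, Real.rpow_natCast, ← div_eq_mul_inv, le_div_iff₀ (by positivity)]
      calc (1 - (q : ℝ)) ^ D * ((m : ℝ) ^ D * (q : ℝ) ^ (m * n)) * (n : ℝ) ^ D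
          = (m * n * (1 - q)) ^ D * (q : ℝ) ^ (m * n) := by
            rw [mul_pow, mul_pow]; ring
        _ ≤ (m * n * (1 - q)) ^ D * Real.exp (-(m * n * (1 - q))) := by gcongr
        _ ≤ _ := h4
  have h4 : 0 ≤ (1 - (q : ℝ)) ^ D * ((m : ℝ) ^ D * (q : ℝ) ^ (m * n)) := by positivity
  have h5 : 0 ≤ (1 - (q : ℝ)) ^ poleOrder s * blockSum q s n := by positivity
  rw [h0]
  calc _ ≤ (C₁ * blockLim R m) * ((D : ℝ) ^ D * (n : ℝ) ^ (-(D : ℝ))) * (C₂ * blockLim s n) :=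
        mul_le_mul (mul_le_mul (h₁ q m hq) h3 h4 (by positivity)) (h₂ q n hq) h5 (by positivity)
    _ = _ := by ring

lemma summable_expBound {R s : List (ℕ × ℕ × ℕ)} {D : ℕ} (hR : Admissible 0 (effExp R))
    (hs : Admissible D (effExp s)) (C : ℝ) :
    Summable fun p : ℕ × ℕ =>
      C * (blockLim R p.1 * ((p.2 : ℝ) ^ (-(D : ℝ)) * blockLim s p.2)) := by
  have h1 : Summable (blockLim R) := by simpa using summable_blockLim hR
  have h2 := summable_blockLim hs
  exact (h1.mul_of_nonneg h2 (fun n => blockLim_nonneg R n)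
    fun n => mul_nonneg (by positivity) (blockLim_nonneg s n)).mul_left C

lemma summable_expTerm {R s : List (ℕ × ℕ × ℕ)} {D : ℕ} (hsD : s = [] → D = 0)
    (hR : Admissible 0 (effExp R)) (hs : Admissible D (effExp s)) {q : ℝ≥0} (hq : q < 1) :
    Summable (expTerm R s D q) := by
  obtain ⟨C, hC, h⟩ := expTerm_le R s hsD
  have hq' : 0 < 1 - (q : ℝ) := sub_pos.2 (by exact_mod_cast hq)
  rw [← NNReal.summable_coe]
  have h1 : Summable fun p : ℕ × ℕ =>
      (1 - (q : ℝ)) ^ (poleOrder s + D + poleOrder R) * (expTerm R s D q p : ℝ) :=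
    Summable.of_nonneg_of_le (fun p => by positivity) (fun p => h q p hq)
      (summable_expBound hR hs C)
  exact (summable_mul_left_iff (by positivity)).1 h1

lemma tendsto_tsum_expTerm {R s : List (ℕ × ℕ × ℕ)} {D : ℕ} (hsD : s = [] → D = 0)
    (hR : Admissible 0 (effExp R)) (hs : Admissible D (effExp s)) :
    Tendsto (fun q : ℝ≥0 => (1 - (q : ℝ)) ^ (poleOrder s + D + poleOrder R) *
      ∑' p, (expTerm R s D q p : ℝ)) (𝓝[<] 1)
      (𝓝 (if D = 0 then (∑' n, blockLim R n) * ∑' n, blockLim s n else 0)) := by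
  obtain ⟨C, hC, h⟩ := expTerm_le R s hsD
  have h1 := tendsto_tsum_of_dominated_convergence (summable_expBound hR hs C)
    (tendsto_expTerm R s D) (by
      filter_upwards [self_mem_nhdsWithin] with q hq p
      have hq' := one_sub_nonneg hq
      rw [Real.norm_of_nonneg (by positivity)]
      exact h q p hq)
  simp only [tsum_mul_left] at h1
  convert h1 using 2
  split_ifs with hD
  · subst hD
    have hs' : Admissible 0 (effExp s) := by simpa using hs
    have h2 : Summable (blockLim R) := by simpa using summable_blockLim hR
    have h3 : Summable (blockLim s) := by simpa using summable_blockLim hs'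
    rw [one_mul, h2.tsum_mul_tsum h3 (h2.mul_of_nonneg h3 (fun n => blockLim_nonneg R n)
      fun n => blockLim_nonneg s n)]
  · rw [zero_mul]

lemma Expansion.length_nil {rl : List (ℕ × ℕ)} (E : Expansion rl) (i : E.ι) (h : E.s i = []) :
    rl = [] ∧ E.D i = 0 := by
  have h1 := E.length_eq i
  rw [h, List.length_nil] at h1
  obtain rfl := List.length_eq_zero_iff.1 h1.symm
  have h2 := E.poleOrder_add i
  simp only [List.map_nil, List.sum_nil] at h2
  exact ⟨rfl, by omega⟩

lemma ne_top_of_summable {α : Type*} {f : α → ℝ≥0} (h : Summable f) :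
    ∑' x, (f x : ℝ≥0∞) ≠ ⊤ := ENNReal.tsum_coe_ne_top_iff_summable.2 h

lemma toReal_tsum_coe {α : Type*} (f : α → ℝ≥0) :
    (∑' x, (f x : ℝ≥0∞)).toReal = ∑' x, (f x : ℝ) := by
  rw [ENNReal.tsum_toReal_eq fun _ => ENNReal.coe_ne_top]
  rfl

/-- The limit of the sum with the variables in `rl` large and those in `R` bounded. -/
def Expansion.limit {rl : List (ℕ × ℕ)} (E : Expansion rl) (R : List (ℕ × ℕ × ℕ)) : ℝ :=
  ∑ i, (E.c i : ℝ) * if E.D i = 0 then (∑' n, blockLim R n) * ∑' n, blockLim (E.s i) n else 0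

lemma Expansion.tendsto {rl : List (ℕ × ℕ)} (E : Expansion rl) {R : List (ℕ × ℕ × ℕ)}
    (hrl : Admissible 0 (rl.map fun t => (t.1 : ℤ) - t.2 + 1)) (hR : Admissible 0 (effExp R)) :
    Tendsto (fun q : ℝ≥0 => (1 - (q : ℝ)) ^ ((rl.map fun t => t.1 + 1).sum + poleOrder R) *
      ∑' m, (blockSum q (toBlocks rl.reverse ++ R) m : ℝ)) (𝓝[<] 1) (𝓝 (E.limit R)) := by
  have hs : ∀ i, Admissible (E.D i) (effExp (E.s i)) := fun i => by
    simpa using E.admissible i 0 hrl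
  have hsD : ∀ i, E.s i = [] → E.D i = 0 := fun i h => (E.length_nil i h).2
  have h := tendsto_finsetSum Finset.univ fun i _ =>
    (tendsto_tsum_expTerm (hsD i) hR (hs i)).const_mul (E.c i : ℝ)
  refine h.congr' ?_
  filter_upwards [self_mem_nhdsWithin] with q hq
  have h1 := congrArg ENNReal.toReal (E.tsum_eq_tsum_expTerm hq R)
  rw [toReal_tsum_coe, ENNReal.toReal_sum fun i _ => ENNReal.mul_ne_top (ENNReal.natCast_ne_top _)
    (ne_top_of_summable (summable_expTerm (hsD i) hR (hs i) hq))] at h1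
  rw [h1, Finset.mul_sum]
  refine Finset.sum_congr rfl fun i _ => ?_
  rw [ENNReal.toReal_mul, toReal_tsum_coe, E.poleOrder_add, ENNReal.toReal_natCast]
  ring

/-- A lower bound for the sum, from a single summand of the expansion. -/
lemma Expansion.exists_lower {rl : List (ℕ × ℕ)} (E : Expansion rl) (R : List (ℕ × ℕ × ℕ)) :
    ∃ (g : ℝ≥0 → ℝ≥0) (κ : ℝ), 0 < κ ∧
      Tendsto (fun q : ℝ≥0 => (1 - (q : ℝ)) ^ ((rl.map fun t => t.1 + 1).sum + poleOrder R) *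
        (g q : ℝ)) (𝓝[<] 1) (𝓝 κ) ∧
      ∀ q < 1, (g q : ℝ≥0∞) ≤ ∑' m, (blockSum q (toBlocks rl.reverse ++ R) m : ℝ≥0∞) := by
  obtain ⟨i, hi⟩ := E.exists_D_eq_zero
  -- The chain n, n-1, …, 1 of full length makes `blockLim` positive at this point, and D = 0 makes
  -- the coupling tend to 1.
  refine ⟨fun q => expTerm R (E.s i) (E.D i) q (R.length, (E.s i).length), _, ?_,
    by simpa only [E.poleOrder_add] using tendsto_expTerm R (E.s i) (E.D i) (R.length, (E.s i).length),
    fun q hq => ?_⟩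
  · rw [if_pos hi, one_mul]
    exact mul_pos (blockLim_length_pos R) (blockLim_length_pos _)
  · rw [E.tsum_eq_tsum_expTerm hq R]
    have h1 : (1 : ℝ≥0∞) ≤ E.c i := by exact_mod_cast E.c_pos i
    calc (expTerm R (E.s i) (E.D i) q (R.length, (E.s i).length) : ℝ≥0∞)
        ≤ ∑' p, (expTerm R (E.s i) (E.D i) q p : ℝ≥0∞) := ENNReal.le_tsum _
      _ ≤ (E.c i : ℝ≥0∞) * ∑' p, (expTerm R (E.s i) (E.D i) q p : ℝ≥0∞) :=
        le_mul_of_one_le_left zero_le h1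
      _ ≤ _ := Finset.single_le_sum (f := fun i => (E.c i : ℝ≥0∞) *
        ∑' p, (expTerm R (E.s i) (E.D i) q p : ℝ≥0∞)) (fun _ _ => zero_le) (Finset.mem_univ i)

/-- Only a bound is wanted, so no expansion is needed: the surplus x turns a possibly divergent
limit series into the convergent ∑ n^{-x} `blockLim R n`. -/
lemma exists_upper {R : List (ℕ × ℕ × ℕ)} (hne : R ≠ []) {x : ℝ} (hx : 0 < x)
    (hR : Admissible x (effExp R)) : ∃ K : ℝ, ∀ q : ℝ≥0, q < 1 →
      (Summable fun n => (blockSum q R n : ℝ)) ∧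
      (1 - (q : ℝ)) ^ (poleOrder R + x) * ∑' n, (blockSum q R n : ℝ) ≤ K := by
  obtain ⟨⟨a, e, b⟩, R, rfl⟩ := List.exists_cons_of_ne_nil hne
  obtain ⟨C, hC, h⟩ := blockSum_cons_le_rpow a e b R hx
  have hs := (summable_blockLim hR).mul_left C
  refine ⟨∑' n : ℕ, C * ((n : ℝ) ^ (-x) * blockLim ((a, e, b) :: R) n), fun q hq => ?_⟩
  have hq' : 0 < 1 - (q : ℝ) := sub_pos.2 (by exact_mod_cast hq)
  have h1 : Summable fun n => (1 - (q : ℝ)) ^ (poleOrder ((a, e, b) :: R) + x) *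
      (blockSum q ((a, e, b) :: R) n : ℝ) :=
    Summable.of_nonneg_of_le (fun n => by positivity) (fun n => h q n hq) hs
  refine ⟨(summable_mul_left_iff (by positivity)).1 h1, ?_⟩
  rw [← tsum_mul_left]
  exact h1.tsum_le_tsum (fun n => h q n hq) hs

/-! ### The limit is a combination of multiple zeta values -/

lemma mzvSpace_mono {a b : ℕ} (h : a ≤ b) : mzvSpace a ≤ mzvSpace b := by
  refine Submodule.span_mono ?_
  rintro z ⟨r, k, h1, h2, h3, h4⟩
  exact ⟨r, k, h1, h2, h3.trans h, h4⟩

lemma tsum_blockLim_mem {s : List (ℕ × ℕ × ℕ)} (h : Admissible 0 (effExp s)) (hs : s ≠ []) :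
    ∑' n, blockLim s n ∈ mzvSpace (poleOrder s) := by
  obtain ⟨z, hz, h1⟩ := blockLim_hasSumIn h hs
  rwa [h1.tsum_eq]

lemma tsum_blockLim_nil : ∑' n, blockLim [] n = 1 := by
  rw [tsum_eq_single 0]
  · simp [blockLim]
  · intro n hn
    simp [blockLim, hn]

/-- Each surviving summand is a product of two convergent nested sums. An empty block contributes
the factor 1, which is not a listed generator, so it is dropped instead of multiplied; hence not
both blocks may be empty. -/
lemma Expansion.limit_mem {rl : List (ℕ × ℕ)} (E : Expansion rl) {R : List (ℕ × ℕ × ℕ)}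
    (hrl : Admissible 0 (rl.map fun t => (t.1 : ℤ) - t.2 + 1)) (hR : Admissible 0 (effExp R))
    (hne : rl ≠ [] ∨ R ≠ []) :
    E.limit R ∈ mzvSpace ((rl.map fun t => t.1 + 1).sum + poleOrder R) := by
  refine Submodule.sum_mem _ fun i _ => ?_
  rw [← nsmul_eq_mul]
  refine Submodule.smul_of_tower_mem _ _ ?_
  split_ifs with hD
  · have hs : Admissible 0 (effExp (E.s i)) := by simpa [hD] using E.admissible i 0 hrl
    have hp := E.poleOrder_add i
    rw [hD, add_zero] at hp
    rw [← hp]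
    by_cases hsn : E.s i = []
    · have hRn : R ≠ [] := hne.resolve_left (not_not.2 (E.length_nil i hsn).1)
      rw [hsn, tsum_blockLim_nil, mul_one]
      exact mzvSpace_mono (by omega) (tsum_blockLim_mem hR hRn)
    · by_cases hRn : R = []
      · rw [hRn, tsum_blockLim_nil, one_mul]
        exact mzvSpace_mono (by omega) (tsum_blockLim_mem hs hsn)
      · rw [add_comm]
        exact mul_mem_mzvSpace (tsum_blockLim_mem hR hRn) (tsum_blockLim_mem hs hsn)
  · exact zero_mem _

/-! ### The exponents -/

/-- The number `exponent` for lists. -/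
def listExponent (L : List (ℕ × ℕ)) (j : ℕ) : ℕ :=
  ((L.take j).map fun t => t.1 + 1).sum + ((L.drop j).map fun t => t.2 + 1).sum

lemma sum_ite_eq_listExponent (r : ℕ) (d l : Fin r → ℕ) (j : ℕ) :
    (∑ i : Fin r, if (i : ℕ) < j then d i + 1 else l i + 1) =
      listExponent (List.ofFn fun i => (d i, l i)) j := by
  induction r generalizing j with
  | zero => simp [listExponent]
  | succ r ih =>
    rw [Fin.sum_univ_succ, List.ofFn_succ]
    cases j with
    | zero =>
      have := ih (fun i => d i.succ) (fun i => l i.succ) 0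
      simp only [listExponent, Nat.not_lt_zero, if_false, List.take_zero, List.drop_zero,
        List.map_nil, List.map_cons, List.sum_nil, List.sum_cons, zero_add] at this ⊢
      rw [this]
    | succ j =>
      have := ih (fun i => d i.succ) (fun i => l i.succ) j
      simp only [listExponent, Fin.val_zero, Fin.val_succ, Nat.succ_pos, if_true,
        Nat.add_lt_add_iff_right, List.take_succ_cons, List.drop_succ_cons, List.map_cons,
        List.sum_cons] at this ⊢
      rw [this]
      ring

/-- The sum of l_i - d_i over the first b indices is `listExponent L 0` minus `listExponent L b`, so
admissibility is a comparison of exponents with the one at j = 0. -/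
lemma admissible_of_listExponent_lt (L : List (ℕ × ℕ)) (c : ℝ)
    (h : ∀ b, 1 ≤ b → b ≤ L.length → (listExponent L b : ℝ) < listExponent L 0 + c) :
    Admissible c (L.map fun t => (t.2 : ℤ) - t.1 + 1) := by
  induction L generalizing c with
  | nil => trivial
  | cons t L ih =>
    have h0 : ((listExponent (t :: L) 0 : ℕ) : ℝ) = t.2 + 1 + listExponent L 0 := by
      simp [listExponent]
    have h1 : ∀ b, ((listExponent (t :: L) (b + 1) : ℕ) : ℝ) = t.1 + 1 + listExponent L b := by
      intro b
      simp [listExponent]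
      ring
    rw [List.map_cons]
    refine ⟨?_, ih _ fun b hb hbl => ?_⟩
    · have := h 1 le_rfl (by simp)
      rw [h0, h1 0] at this
      push_cast
      linarith
    · have := h (b + 1) (by omega) (by simpa using hbl)
      rw [h0, h1 b] at this
      push_cast
      linarith

lemma effExp_toBlocks (L : List (ℕ × ℕ)) :
    effExp (toBlocks L) = L.map fun t => (t.2 : ℤ) - t.1 + 1 := by
  simp [effExp, toBlocks, Function.comp_def]

lemma poleOrder_toBlocks (L : List (ℕ × ℕ)) :
    poleOrder (toBlocks L) = (L.map fun t => t.2 + 1).sum := by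
  simp [poleOrder, toBlocks, Function.comp_def]

lemma listExponent_add (L : List (ℕ × ℕ)) (j b : ℕ) :
    listExponent L (j + b) =
      ((L.take j).map fun t => t.1 + 1).sum + listExponent (L.drop j) b := by
  simp only [listExponent, List.take_add, List.map_append, List.sum_append, List.drop_drop]
  ring

lemma admissible_drop (L : List (ℕ × ℕ)) (j : ℕ)
    (h : ∀ b ≤ L.length, j < b → listExponent L b < listExponent L j) :
    Admissible 0 (effExp (toBlocks (L.drop j))) := by
  rw [effExp_toBlocks]
  refine admissible_of_listExponent_lt _ _ fun b hb hbl => ?_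
  rw [List.length_drop] at hbl
  have h1 := h (j + b) (by omega) (by omega)
  have h2 := listExponent_add L j 0
  rw [listExponent_add] at h1
  rw [add_zero] at h2
  rw [add_zero]
  exact_mod_cast (by omega : listExponent (L.drop j) b < listExponent (L.drop j) 0)

/-- Conjugation swaps d with l and reverses the order. On the reversed swapped list the exponent at
b is the original one at j-b up to a constant, reducing the claim to the comparison with position 0.
-/
lemma admissible_take_reverse (L : List (ℕ × ℕ)) {j : ℕ} (hj : j ≤ L.length)
    (h : ∀ b < j, listExponent L b < listExponent L j) :
    Admissible 0 ((L.take j).reverse.map fun t => (t.1 : ℤ) - t.2 + 1) := by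
  have h1 : ((L.take j).reverse.map fun t => (t.1 : ℤ) - t.2 + 1) =
      (((L.take j).reverse.map Prod.swap).map fun t => (t.2 : ℤ) - t.1 + 1) := by
    simp [Function.comp_def]
  have hlen : (L.take j).length = j := by simpa using hj
  have h2 : ∀ b ≤ j, listExponent ((L.take j).reverse.map Prod.swap) b +
      ((L.drop j).map fun t => t.2 + 1).sum = listExponent L (j - b) := by
    intro b hb
    have h3 : L.drop (j - b) = (L.take j).drop (j - b) ++ L.drop j := by
      conv_lhs => rw [← List.take_append_drop j L, List.drop_append_of_le_length (by omega)]
    have h4 : L.take (j - b) = (L.take j).take (j - b) := by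
      rw [List.take_take, min_eq_left (by omega)]
    rw [listExponent, listExponent, h3, h4, ← List.map_take, ← List.map_drop, List.take_reverse,
      List.drop_reverse, hlen]
    simp only [List.map_reverse, List.sum_reverse, List.map_map, Function.comp_def, Prod.fst_swap,
      Prod.snd_swap, List.map_append, List.sum_append]
    ring
  rw [h1]
  refine admissible_of_listExponent_lt _ _ fun b hb hbl => ?_
  rw [List.length_map, List.length_reverse, hlen] at hbl
  have h5 := h2 b hbl
  have h6 := h2 0 (Nat.zero_le _)
  have h7 := h (j - b) (by omega)
  rw [Nat.sub_zero] at h6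
  rw [add_zero]
  exact_mod_cast (by omega : listExponent ((L.take j).reverse.map Prod.swap) b <
    listExponent ((L.take j).reverse.map Prod.swap) 0)

/-- The list of the exponents `(d_i, l_i)`. -/
def pairList {r : ℕ} (d l : Fin r → ℕ) : List (ℕ × ℕ) := List.ofFn fun i => (d i, l i)

lemma length_pairList {r : ℕ} (d l : Fin r → ℕ) : (pairList d l).length = r := List.length_ofFn

lemma exponent_eq {r : ℕ} (d l : Fin r → ℕ) (j : Fin (r + 1)) :
    exponent d l j = listExponent (pairList d l) j :=
  sum_ite_eq_listExponent r d l j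

lemma exponent_le_maxExponent {r : ℕ} (d l : Fin r → ℕ) (j : Fin (r + 1)) :
    exponent d l j ≤ maxExponent d l :=
  Finset.le_sup' (exponent d l) (Finset.mem_univ j)

lemma listExponent_le_maxExponent {r : ℕ} (d l : Fin r → ℕ) {b : ℕ} (hb : b ≤ r) :
    listExponent (pairList d l) b ≤ maxExponent d l := by
  have := exponent_le_maxExponent d l ⟨b, Nat.lt_succ_of_le hb⟩
  rwa [exponent_eq] at this

/-! ### Degree and degree limit -/

/-- The value of the `q`-bracket of `Ψ(∏ x_i^{d_i} y_i^{l_i})`. -/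
def bracketValue {r : ℕ} (d l : Fin r → ℕ) (q : ℝ≥0) : ℝ :=
  ∑' n, (blockSum q (toBlocks (pairList d l)) n : ℝ)

lemma toBlocks_pairList_ne_nil {r : ℕ} (hr : 1 ≤ r) (d l : Fin r → ℕ) :
    toBlocks (pairList d l) ≠ [] := by
  intro h
  have := congrArg List.length h
  rw [toBlocks, List.length_map, length_pairList, List.length_nil] at this
  omega

lemma exists_upper_bracketValue {r : ℕ} (hr : 1 ≤ r) (d l : Fin r → ℕ) {ε : ℝ} (hε : 0 < ε) :
    ∃ K : ℝ, ∀ q : ℝ≥0, q < 1 →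
      (Summable fun n => (blockSum q (toBlocks (pairList d l)) n : ℝ)) ∧
      (1 - (q : ℝ)) ^ (maxExponent d l + ε) * bracketValue d l q ≤ K := by
  have hp : (poleOrder (toBlocks (pairList d l)) : ℝ) = listExponent (pairList d l) 0 := by
    rw [poleOrder_toBlocks]
    simp [listExponent]
  have h0 : (listExponent (pairList d l) 0 : ℝ) ≤ maxExponent d l := by
    exact_mod_cast listExponent_le_maxExponent d l (Nat.zero_le r)
  -- This surplus raises the pole order at j = 0 to the maximum plus ε, which strictly exceeds every
  -- exponent.
  have hx : 0 < (maxExponent d l : ℝ) - listExponent (pairList d l) 0 + ε := by linarith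
  have hadm : Admissible ((maxExponent d l : ℝ) - listExponent (pairList d l) 0 + ε)
      (effExp (toBlocks (pairList d l))) := by
    rw [effExp_toBlocks]
    refine admissible_of_listExponent_lt _ _ fun b _ hb => ?_
    rw [length_pairList] at hb
    have : (listExponent (pairList d l) b : ℝ) ≤ maxExponent d l := by
      exact_mod_cast listExponent_le_maxExponent d l hb
    linarith
  obtain ⟨K, hK⟩ := exists_upper (toBlocks_pairList_ne_nil hr d l) hx hadm
  refine ⟨K, fun q hq => ⟨(hK q hq).1, ?_⟩⟩
  have := (hK q hq).2
  rw [hp] at this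
  rwa [← add_assoc, add_sub_cancel] at this

lemma summable_bracket {r : ℕ} (hr : 1 ≤ r) (d l : Fin r → ℕ) {q : ℝ≥0} (hq : q < 1) :
    Summable fun n => (blockSum q (toBlocks (pairList d l)) n : ℝ) := by
  obtain ⟨K, hK⟩ := exists_upper_bracketValue hr d l one_pos
  exact (hK q hq).1

lemma hasSum_qBracketTerm {r : ℕ} (hr : 1 ≤ r) (d l : Fin r → ℕ) {q : ℝ≥0} (hq : q < 1) :
    HasSum (qBracketTerm (Psi (monom d l)) q) (bracketValue d l q) := by
  have h1 := tsum_qBracketTerm hq d l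
  have h2 := ne_top_of_summable (NNReal.summable_coe.1 (summable_bracket hr d l hq))
  have h3 : Summable (qBracketTerm (Psi (monom d l)) q) := by
    have := ENNReal.summable_toReal (h1.trans_ne h2)
    simpa only [ENNReal.toReal_ofReal (qBracketTerm_nonneg d l q _)] using this
  have h4 := congrArg ENNReal.toReal h1
  rw [toReal_tsum_coe, ENNReal.tsum_toReal_eq fun _ => ENNReal.ofReal_ne_top] at h4
  simp only [ENNReal.toReal_ofReal (qBracketTerm_nonneg d l q _)] at h4
  rw [bracketValue, pairList, ← h4]
  exact h3.hasSum

lemma tendsto_toNNReal_one : Tendsto Real.toNNReal (𝓝[<] 1) (𝓝[<] 1) := by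
  refine tendsto_nhdsWithin_iff.2 ⟨?_, ?_⟩
  · have := (continuous_real_toNNReal.tendsto (1 : ℝ)).mono_left
      (nhdsWithin_le_nhds (s := Set.Iio 1))
    rwa [Real.toNNReal_one] at this
  · filter_upwards [self_mem_nhdsWithin] with q hq
    exact Real.toNNReal_lt_one.2 hq

lemma tendsto_coe_one_left : Tendsto (fun q : ℝ≥0 => (q : ℝ)) (𝓝[<] 1) (𝓝[<] 1) := by
  refine tendsto_nhdsWithin_iff.2 ⟨tendsto_coe_one, ?_⟩
  filter_upwards [self_mem_nhdsWithin] with q hq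
  exact NNReal.coe_lt_one.2 hq

lemma hasLimitAt_iff {r : ℕ} (hr : 1 ≤ r) (d l : Fin r → ℕ) (a L : ℝ) :
    HasLimitAt (Psi (monom d l)) a L ↔
      Tendsto (fun q : ℝ≥0 => (1 - (q : ℝ)) ^ a * bracketValue d l q) (𝓝[<] 1) (𝓝 L) := by
  have h0 : ∀ᶠ q : ℝ in 𝓝[<] 1, 0 < q :=
    nhdsWithin_le_nhds (lt_mem_nhds (zero_lt_one' ℝ))
  constructor
  · rintro ⟨-, h⟩
    refine (h.comp tendsto_coe_one_left).congr' ?_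
    filter_upwards [self_mem_nhdsWithin] with q hq
    rw [Function.comp_apply, (hasSum_qBracketTerm hr d l hq).tsum_eq]
  · intro h
    have hs : ∀ᶠ q : ℝ in 𝓝[<] 1, HasSum (qBracketTerm (Psi (monom d l)) q)
        (bracketValue d l q.toNNReal) := by
      filter_upwards [h0, self_mem_nhdsWithin] with q hq hq1
      have := hasSum_qBracketTerm hr d l (Real.toNNReal_lt_one.2 hq1)
      rwa [Real.coe_toNNReal q hq.le] at this
    refine ⟨hs.mono fun q hq => hq.summable, (h.comp tendsto_toNNReal_one).congr' ?_⟩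
    filter_upwards [h0, hs] with q hq hq1
    rw [Function.comp_apply, hq1.tsum_eq, Real.coe_toNNReal q hq.le]

lemma bracketValue_nonneg {r : ℕ} (d l : Fin r → ℕ) (q : ℝ≥0) : 0 ≤ bracketValue d l q :=
  tsum_nonneg fun _ => NNReal.coe_nonneg _

lemma tendsto_one_sub_rpow {ε : ℝ} (hε : 0 < ε) :
    Tendsto (fun q : ℝ≥0 => (1 - (q : ℝ)) ^ ε) (𝓝[<] 1) (𝓝 0) := by
  have h := ((tendsto_const_nhds (x := (1 : ℝ))).sub tendsto_coe_one).rpow_const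
    (p := ε) (Or.inr hε.le)
  rwa [sub_self, Real.zero_rpow hε.ne'] at h

lemma hasLimitAt_zero {r : ℕ} (hr : 1 ≤ r) (d l : Fin r → ℕ) {a : ℝ} (ha : maxExponent d l < a) :
    HasLimitAt (Psi (monom d l)) a 0 := by
  rw [hasLimitAt_iff hr]
  set ε : ℝ := (a - maxExponent d l) / 2 with hε
  have hε0 : 0 < ε := by linarith
  obtain ⟨K, hK⟩ := exists_upper_bracketValue hr d l hε0
  have h := (tendsto_one_sub_rpow hε0).mul_const K
  rw [zero_mul] at h
  refine tendsto_of_tendsto_of_tendsto_of_le_of_le' tendsto_const_nhds h ?_ ?_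
  all_goals
    filter_upwards [self_mem_nhdsWithin] with q hq
    have hq' : 0 < 1 - (q : ℝ) := sub_pos.2 (NNReal.coe_lt_one.2 hq)
  · exact mul_nonneg (by positivity) (bracketValue_nonneg d l q)
  · have h1 : (1 - (q : ℝ)) ^ a = (1 - (q : ℝ)) ^ ε * (1 - (q : ℝ)) ^ (maxExponent d l + ε) := by
      rw [← Real.rpow_add hq']
      congr 1
      rw [hε]
      ring
    rw [h1, mul_assoc]
    gcongr
    exact (hK q hq).2

lemma toBlocks_take_append_drop (L : List (ℕ × ℕ)) (j : ℕ) :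
    toBlocks (L.take j).reverse.reverse ++ toBlocks (L.drop j) = toBlocks L := by
  rw [List.reverse_reverse, toBlocks, toBlocks, ← List.map_append, List.take_append_drop, toBlocks]

lemma sum_take_reverse_add (L : List (ℕ × ℕ)) (j : ℕ) :
    ((L.take j).reverse.map fun t => t.1 + 1).sum + poleOrder (toBlocks (L.drop j)) =
      listExponent L j := by
  rw [poleOrder_toBlocks, List.map_reverse, List.sum_reverse, listExponent]

/-- A limit at some a below the maximum would force (1-q)^max ⟨f⟩_q to tend to 0, whereas the lower
bound at a maximising j keeps it above a function with positive limit κ. -/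
lemma not_hasLimitAt {r : ℕ} (hr : 1 ≤ r) (d l : Fin r → ℕ) {a : ℝ} (ha : a < maxExponent d l)
    (L : ℝ) : ¬HasLimitAt (Psi (monom d l)) a L := by
  rw [hasLimitAt_iff hr]
  intro h
  obtain ⟨j, -, hj⟩ := Finset.exists_mem_eq_sup' Finset.univ_nonempty (exponent d l)
  obtain ⟨g, κ, hκ, hg, hle⟩ :=
    (expansion ((pairList d l).take j).reverse).exists_lower (toBlocks ((pairList d l).drop j))
  rw [toBlocks_take_append_drop] at hle
  rw [sum_take_reverse_add, ← exponent_eq, ← hj] at hg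
  have h1 := (tendsto_one_sub_rpow (sub_pos.2 ha)).mul h
  rw [zero_mul] at h1
  have : (𝓝[<] (1 : ℝ≥0)).NeBot := nhdsLT_neBot_of_exists_lt ⟨0, one_pos⟩
  refine absurd (le_of_tendsto_of_tendsto hg h1 ?_) (not_le.2 hκ)
  filter_upwards [self_mem_nhdsWithin] with q hq
  have hq' : 0 < 1 - (q : ℝ) := sub_pos.2 (NNReal.coe_lt_one.2 hq)
  have h2 : (g q : ℝ) ≤ bracketValue d l q := by
    have := ENNReal.toReal_mono (ne_top_of_summable (NNReal.summable_coe.1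
      (summable_bracket hr d l hq))) (hle q hq)
    rwa [toReal_tsum_coe, ENNReal.coe_toReal] at this
  rw [← mul_assoc, ← Real.rpow_add hq', sub_add_cancel, Real.rpow_natCast]
  exact mul_le_mul_of_nonneg_left h2 (by positivity)

lemma degree_psi_monom {r : ℕ} (hr : 1 ≤ r) (d l : Fin r → ℕ) :
    degree (Psi (monom d l)) = (((maxExponent d l : ℕ) : ℝ) : EReal) := by
  refine le_antisymm (le_of_forall_gt fun b hb => ?_) (le_sInf ?_)
  · obtain ⟨a, h1, h2⟩ := EReal.lt_iff_exists_real_btwn.1 hb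
    refine lt_of_le_of_lt (sInf_le ⟨a, ⟨0, hasLimitAt_zero hr d l ?_⟩, rfl⟩) h2
    exact_mod_cast h1
  · rintro _ ⟨a, ⟨L, hL⟩, rfl⟩
    refine EReal.coe_le_coe_iff.2 (not_lt.1 fun ha => not_hasLimitAt hr d l ha L hL)

lemma exists_isDegreeLimit {r : ℕ} (hr : 1 ≤ r) (d l : Fin r → ℕ)
    (h : ∃! j : Fin (r + 1), exponent d l j = maxExponent d l) :
    ∃ Z : ℝ, IsDegreeLimit (Psi (monom d l)) Z ∧ Z ∈ mzvSpace (maxExponent d l) := by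
  obtain ⟨j, hj, huniq⟩ := h
  have hj' : (j : ℕ) ≤ r := Nat.lt_succ_iff.1 j.2
  -- The inequalities for b < j give convergence of the transferred left sums, those for b > j
  -- convergence of the right sum.
  have hlt : ∀ b ≤ r, b ≠ j → listExponent (pairList d l) b < listExponent (pairList d l) j := by
    intro b hb hbj
    rw [← exponent_eq, hj]
    refine lt_of_le_of_ne (listExponent_le_maxExponent d l hb) fun h => hbj ?_
    have := huniq ⟨b, Nat.lt_succ_of_le hb⟩ ((exponent_eq d l _).trans h)
    rw [← this]
  have hrl := admissible_take_reverse (pairList d l) (j := j) (by rwa [length_pairList])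
    fun b hb => hlt b (by omega) hb.ne
  have hR := admissible_drop (pairList d l) j fun b hb hbj =>
    hlt b (by rwa [length_pairList] at hb) hbj.ne'
  have hne : ((pairList d l).take j).reverse ≠ [] ∨ toBlocks ((pairList d l).drop j) ≠ [] := by
    by_contra hc
    push Not at hc
    have h1 := toBlocks_take_append_drop (pairList d l) j
    rw [hc.1, hc.2] at h1
    exact toBlocks_pairList_ne_nil hr d l h1.symm
  let E := expansion ((pairList d l).take j).reverse
  have hlim := E.tendsto hrl hR
  have hmem := E.limit_mem hrl hR hne
  rw [sum_take_reverse_add, ← exponent_eq, hj] at hlim hmem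
  rw [toBlocks_take_append_drop] at hlim
  refine ⟨_, ⟨maxExponent d l, degree_psi_monom hr d l, ?_⟩, hmem⟩
  rw [hasLimitAt_iff hr]
  simpa only [Real.rpow_natCast, bracketValue] using hlim

end PartitionAnalogue

end

theorem mainTheorem1 (r : ℕ) (hr : 1 ≤ r) (d l : Fin r → ℕ) :
    PartitionAnalogue.degree (PartitionAnalogue.Psi (PartitionAnalogue.monom d l)) =
        (((PartitionAnalogue.maxExponent d l : ℕ) : ℝ) : EReal) ∧
      ((∃! j : Fin (r + 1),
          PartitionAnalogue.exponent d l j = PartitionAnalogue.maxExponent d l) →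
        ∃ Z : ℝ,
          PartitionAnalogue.IsDegreeLimit
            (PartitionAnalogue.Psi (PartitionAnalogue.monom d l)) Z ∧
          Z ∈ PartitionAnalogue.mzvSpace (PartitionAnalogue.maxExponent d l)) :=
  ⟨PartitionAnalogue.degree_psi_monom hr d l, PartitionAnalogue.exists_isDegreeLimit hr d l⟩
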